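/- \textbf{Setting.} Let $n\ge 1$ be an integer and $p_1,\dots,p_n\in(0,1]$. For each $i\in\{1,\dots,n\}$ let $(B^{(i)}_j)_{j\ge 0}$ be a Bernoulli process with parameter $p_i$, all variables being jointly independent. The \emph{Seed Search and Encoding Problem} (SSEP) is to produce a bitstring $M$ that encodes, for every $i$, a seed $S_i\in\mathbb N_0$ with $B^{(i)}_{S_i}=1$. Put $M^{\mathrm{OPT}}=\sum_{i=1}^n\log_2(1/p_i)$ and $T_i^{\mathrm{OPT}}=1/p_i$. \textbf{Algorithm (Full CONSENSUS).} The parameters are integers $w,\ell_1,\dots,\ell_n\ge 0$. The algorithm maintains $\sigma_0\in\{0,\dots,2^w-1\}$, an index $i$ and, for $1\le j\le i$, fragments $\sigma_j\in\{0,\dots,2^{\ell_j}-1\}$. At any time let $S_i\in\{0,1\}^w$, identified with a number in $\{0,\dots,2^w-1\}$, be the suffix of length $w$ of the concatenation of the binary representations of $\sigma_0,\sigma_1,\dots,\sigma_i$, where $\sigma_0$ is written with $w$ bits and $\sigma_j$ with $\ell_j$ bits. For $\sigma_0=0,1,\dots,2^w-1$ in turn, set $i=1$, $\sigma_1=0$,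 and repeat the following step while $i>0$. Inspect $B^{(i)}_{S_i}$. If it equals $1$: if $i=n$, stop and return $M$, the concatenation of the binary representations of $\sigma_0,\dots,\sigma_n$; otherwise increase $i$ by $1$ and set the new $\sigma_i$ to $0$. If it equals $0$: decrease $i$ by $1$ as long as $i>0$ and $\sigma_i=2^{\ell_i}-1$; then, if $i>0$, increase $\sigma_i$ by $1$. If all values of $\sigma_0$ have been used without success, return $\bot$. Let $T_i$ be the number of inspections of variables of the $i$th family $(B^{(i)}_j)_j$ during the run. \textbf{Theorem (Performance of Full CONSENSUS).} Let $c>0$ be a constant. Let $n\ge1$, $p_1,\dots,p_n\in(n^{-c},1]$ and $\varepsilon\in(n^{-c},1]$. There is a unique sequence $\ell_1,\dots,\ell_n\in\mathbb N_0$ with \[\sum_{j=1}^i\ell_j=\Big\lceil \varepsilon i+\sum_{j=1}^i\log_2(1/p_j)\Big\rceil\qquad\text{for all } i\in\{1,\dots,n\}.\] Run Full CONSENSUS with this sequence and an integer $w\ge(2+7c)\log_2 n$. Then there is an event $E$ with $\Pr[E]>0$ and $\Pr[E]=1-O(n^{-c})$ on which the run solves the SSEP: it returns a bitstring $M$ with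 $|M|=\lceil M^{\mathrm{OPT}}+\varepsilon n+w\rceil$ such that, for every $i\in\{1,\dots,n\}$, the substring of $M$ of length $w$ at offset $\sum_{j=1}^i\ell_j$ is $S_i\in\{0,1\}^w$ (for the returned $\sigma_0,\dots,\sigma_n$), and $B^{(i)}_{S_i}=1$. Moreover, $\mathbb E[T_i\mid E]=O(T_i^{\mathrm{OPT}}/\varepsilon)$ for all $i\in\{1,\dots,n\}$. The constants in both $O(\cdot)$ depend only on $c$. -/

import Mathlib

open MeasureTheory ProbabilityTheory

namespace Consensus

/-! Families are indexed by `1, …, n` as natural numbers; values at other indices are irrelevant.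
A choice of seed fragments is a function `σ : ℕ → ℕ`, where `σ 0` is the first word and
`σ 1, …, σ n` are the fragments, of bit lengths `ℓ 1, …, ℓ n`. -/

/-- `B i j`, for `1 ≤ i ≤ n` and `j ∈ ℕ`, are jointly independent Bernoulli variables, where
`B i j` has parameter `p i`. -/
structure IsBernoulliFamily {Ω : Type*} [MeasurableSpace Ω] (μ : Measure Ω) (n : ℕ) (p : ℕ → ℝ)
    (B : ℕ → ℕ → Ω → Bool) : Prop where
  measurable : ∀ i ∈ Finset.Icc 1 n, ∀ j, Measurable (B i j)
  indep : iIndepFun (fun (a : (Set.Icc 1 n : Set ℕ) × ℕ) => B a.1 a.2) μ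
  prob : ∀ i ∈ Finset.Icc 1 n, ∀ j, μ {ω | B i j ω = true} = ENNReal.ofReal (p i)

/-- The space optimum `∑ i, log₂ (1 / p i)`. -/
noncomputable def optSpace (n : ℕ) (p : ℕ → ℝ) : ℝ :=
  ∑ j ∈ Finset.Icc 1 n, Real.logb 2 (1 / p j)

/-- The optimum `1 / p i` for the number of inspected variables of the `i`th family. -/
noncomputable def optTrials (p : ℕ → ℝ) (i : ℕ) : ℝ := 1 / p i

/-- The bit offset `ℓ 1 + ⋯ + ℓ i`. -/
def offset (ℓ : ℕ → ℕ) (i : ℕ) : ℕ := ∑ j ∈ Finset.Icc 1 i, ℓ j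

/-- The prefix sums of `ℓ` are the numbers `⌈ε i + ∑_{j ≤ i} log₂ (1 / p j)⌉`, `1 ≤ i ≤ n`. -/
def IsFragmentLengths (n : ℕ) (p : ℕ → ℝ) (ε : ℝ) (ℓ : ℕ → ℕ) : Prop :=
  ∀ i ∈ Finset.Icc 1 n,
    (offset ℓ i : ℤ) = ⌈ε * (i : ℝ) + ∑ j ∈ Finset.Icc 1 i, Real.logb 2 (1 / p j)⌉

/-- The number `σ₀ ∘ ⋯ ∘ σᵢ`: the index, within its layer, of the node reached by the choices
`σ 0, …, σ i`, when nodes of layer `j ≥ 1` have `2 ^ ℓ j` children. Its binary representation is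
the concatenation of those of `σ 0, …, σ i`. -/
def node (ℓ σ : ℕ → ℕ) : ℕ → ℕ
  | 0 => σ 0
  | i + 1 => node ℓ σ i * 2 ^ ℓ (i + 1) + σ (i + 1)

/-- The seed `Sᵢ`: the `w`-bit suffix of `σ₀ ∘ ⋯ ∘ σᵢ`. -/
def seed (w : ℕ) (ℓ σ : ℕ → ℕ) (i : ℕ) : ℕ := node ℓ σ i % 2 ^ w

/-- A configuration of the search: about to inspect the variable of family `i` given by the current
choices `σ`, or halted with a returned `σ`, or halted with output `⊥`. -/
inductive Config where
  | search (i : ℕ) (σ : ℕ → ℕ)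
  | found (σ : ℕ → ℕ)
  | exhausted

/-- The inner loop: while `i > 0` and `σ i = 2 ^ ℓ i - 1`, decrease `i`. -/
def backtrack (ℓ σ : ℕ → ℕ) : ℕ → ℕ
  | 0 => 0
  | i + 1 => if σ (i + 1) = 2 ^ ℓ (i + 1) - 1 then backtrack ℓ σ i else i + 1

/-- One iteration of the main loop of the full algorithm on the outcome `b` of the Bernoulli
variables; it inspects exactly one of them. When backtracking leaves layer `1`, the outer loop
moves on to the next value of `σ 0`, if there is one below `2 ^ w`, and restarts at layer `1` with
`σ 1 = 0`. -/
def step (n w : ℕ) (ℓ : ℕ → ℕ) (b : ℕ → ℕ → Bool) : Config → Config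
  | .search i σ =>
    if b i (seed w ℓ σ i) = true then
      if i = n then .found σ
      else .search (i + 1) (Function.update σ (i + 1) 0)
    else
      let k := backtrack ℓ σ i
      if 0 < k then .search k (Function.update σ k (σ k + 1))
      else if σ 0 + 1 < 2 ^ w then
        .search 1 (Function.update (Function.update σ 0 (σ 0 + 1)) 1 0)
      else .exhausted
  | .found σ => .found σ
  | .exhausted => .exhausted

/-- The configuration after `t` steps, starting with `σ 0 = 0`, `σ 1 = 0` and `i = 1`. -/
def run (n w : ℕ) (ℓ : ℕ → ℕ) (b : ℕ → ℕ → Bool) (t : ℕ) : Config :=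
  (step n w ℓ b)^[t] (.search 1 (fun _ => 0))

/-- The run halts and returns `σ 0, …, σ n`. -/
def Returns (n w : ℕ) (ℓ : ℕ → ℕ) (b : ℕ → ℕ → Bool) (σ : ℕ → ℕ) : Prop :=
  ∃ t, run n w ℓ b t = .found σ

/-- The number of inspections of variables of family `i` during the whole run (counted with
multiplicity if the same variable is inspected repeatedly). -/
noncomputable def trials (n w : ℕ) (ℓ : ℕ → ℕ) (b : ℕ → ℕ → Bool) (i : ℕ) : ℕ∞ :=
  Set.encard {t : ℕ | ∃ σ, run n w ℓ b t = .search i σ}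

/-- The `k`-bit binary representation of `m`, most significant bit first. -/
def toBits (k m : ℕ) : List Bool := List.ofFn (fun j : Fin k => m.testBit (k - 1 - j))

/-- The number with the given binary representation, most significant bit first. -/
def ofBits (l : List Bool) : ℕ := l.foldl (fun a b => 2 * a + b.toNat) 0

/-- The bitstring `M`: `w` bits for `σ 0`, followed by `ℓ i` bits for `σ i`, for `i = 1, …, n`. -/
def encode (n w : ℕ) (ℓ σ : ℕ → ℕ) : List Bool :=
  toBits w (σ 0) ++ (List.range n).flatMap (fun j => toBits (ℓ (j + 1)) (σ (j + 1)))

/-- The substring of `M` of length `w` that starts at position `k` (counting from `0`). -/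
def window (w : ℕ) (M : List Bool) (k : ℕ) : List Bool := (M.drop k).take w

/-- `M` solves the seed search and encoding problem with outcome `b`, with respect to the decoding
rule `dec`: the seed decoded from `M` is successful for every `1 ≤ i ≤ n`. -/
def SolvesSSEP (n : ℕ) (b : ℕ → ℕ → Bool) (dec : List Bool → ℕ → ℕ) (M : List Bool) : Prop :=
  ∀ i ∈ Finset.Icc 1 n, b i (dec M i) = true

end Consensus

namespace Consensus

/-! ### Depth first search with an explicit stack -/

/-! The algorithm is a depth-first search in a forest: the node of layer `i` with index `u = σ₀ ∘ ⋯
∘ σᵢ` inspects the variable `u mod 2 ^ w` of family `i`. Until some variable is inspected a second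
time, the search sees fresh independent bits, as if every node had its own variable. The event `E`
is that the search succeeds without any repetition, using only the first `2 ^ κ ≈ n ^ (2c)` values
of `σ₀`. On `E` the actual run is this search (`run_of_freshSuccess`).

In the idealised forest let `q m` be the probability `nodeProb` that a node of layer `m` leads to
layer `n`. The fragment lengths leave a branching surplus of about `2 ^ ε` per layer, and rounding
costs at most a factor 2 overall, so `q m ≥ p m * ε / 4` (`nodeProb_ge`, from `subtree_success_ge`).
Hence all roots fail with probability only `O(n ^ (-c))`. Moreover each inspection in layer `i`
leads to success with probability `q i`, and at most one does, so the expected number of such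
inspections is at most `1 / q i` (`expectedCount_seg_le`).

Repetitions are controlled by the expected number of inspected pairs in layer `i` with congruent
indices. Split the pairs by the layer where the two paths part. The earlier node then lies in a
subtree that failed, and the failure of all its siblings there makes large subtrees cheap: an AM-GM
estimate (`four_pow_mul_pathFailProb_mul_pathProb_le`) bounds the pairs between two subtrees of
layer `m`, without the collision factor, by `q m ^ 2 / q i ^ 2`. Summation gives `O((n + 2 ^ κ) / (2
^ w * q i ^ 2))` per layer.

Both kinds of failure are combined in `potential`: the probability that the whole stack fails, plus
bounds on the expected future colliding pairs and on the expected future hits of variables already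
inspected. It is at least 1 upon failure or repetition and does not increase in mean
(`stepMean_potential_le`), so its initial value bounds the probability of the complement of `E`. For
bounded `n` this may be vacuous; there the event that all variables with index 0 equal 1 supplies a
positive lower bound depending only on `c`. -/

/-- The variable inspected at node `y`, where `y.1` is the layer and `y.2` the index. -/
def label (w : ℕ) (y : ℕ × ℕ) : ℕ × ℕ := (y.1, y.2 % 2 ^ w)

/-- The `k` consecutive nodes of layer `m` that start with index `v`. -/
def seg (m v k : ℕ) : List (ℕ × ℕ) := (List.range' v k).map (Prod.mk m)

@[simp] lemma seg_zero (m v : ℕ) : seg m v 0 = [] := rfl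

lemma seg_succ (m v k : ℕ) : seg m v (k + 1) = (m, v) :: seg m (v + 1) k := by
  simp [seg, List.range'_succ]

lemma seg_append (m v k k' : ℕ) : seg m v (k + k') = seg m v k ++ seg m (v + k) k' := by
  simp only [seg, ← List.map_append]
  congr 1
  exact (List.range'_append_1 ..).symm

lemma mem_seg {m v k : ℕ} {y : ℕ × ℕ} (h : y ∈ seg m v k) : y.1 = m := by
  simp only [seg, List.mem_map] at h
  obtain ⟨a, -, rfl⟩ := h
  rfl

/-- Siblings occupy consecutive indices, so the descendants of a segment in any deeper layer again
form an interval. This reduces collision counting to residues in intervals. -/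
def children (ℓ : ℕ → ℕ) (y : ℕ × ℕ) : List (ℕ × ℕ) :=
  seg (y.1 + 1) (y.2 * 2 ^ ℓ (y.1 + 1)) (2 ^ ℓ (y.1 + 1))

/-- The search started with a stack of pending nodes reaches layer `n` within `t` inspections,
without inspecting any variable in `H` and without inspecting a variable twice. -/
def FreshSuccess (n w : ℕ) (ℓ : ℕ → ℕ) (b : ℕ → ℕ → Bool) :
    ℕ → Finset (ℕ × ℕ) → List (ℕ × ℕ) → Prop
  | 0, _, _ => False
  | _ + 1, _, [] => False
  | t + 1, H, y :: s => label w y ∉ H ∧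
      if b y.1 (y.2 % 2 ^ w) = true then
        y.1 = n ∨ FreshSuccess n w ℓ b t (insert (label w y) H) (children ℓ y ++ s)
      else FreshSuccess n w ℓ b t (insert (label w y) H) s

/-- The number of inspections in layer `i` during the first `t` steps of the search, until it
succeeds or reaches a variable in `H` or one that was inspected before. -/
def freshCount (n w : ℕ) (ℓ : ℕ → ℕ) (b : ℕ → ℕ → Bool) (i : ℕ) :
    ℕ → Finset (ℕ × ℕ) → List (ℕ × ℕ) → ℕ
  | 0, _, _ => 0
  | _ + 1, _, [] => 0
  | t + 1, H, y :: s => if label w y ∈ H then 0 else (if y.1 = i then 1 else 0) +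
      if b y.1 (y.2 % 2 ^ w) = true then
        if y.1 = n then 0
        else freshCount n w ℓ b i t (insert (label w y) H) (children ℓ y ++ s)
      else freshCount n w ℓ b i t (insert (label w y) H) s

/-! ### Configurations of the algorithm as stacks -/

/-- The nodes that remain to be inspected if the subtree of the current node of layer `i` fails,
when only the values below `2 ^ κ` are used for `σ 0`. -/
def pending (κ : ℕ) (ℓ σ : ℕ → ℕ) : ℕ → List (ℕ × ℕ)
  | 0 => seg 1 ((σ 0 + 1) * 2 ^ ℓ 1) ((2 ^ κ - (σ 0 + 1)) * 2 ^ ℓ 1)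
  | i + 1 => seg (i + 1) (node ℓ σ (i + 1) + 1) (2 ^ ℓ (i + 1) - 1 - σ (i + 1)) ++ pending κ ℓ σ i

lemma node_congr {ℓ σ σ' : ℕ → ℕ} {i : ℕ} (h : ∀ j ≤ i, σ j = σ' j) :
    node ℓ σ i = node ℓ σ' i := by
  induction i with
  | zero => exact h 0 le_rfl
  | succ i ih => simp only [node]; rw [ih fun j hj => h j (by omega), h _ le_rfl]

lemma pending_congr {κ : ℕ} {ℓ σ σ' : ℕ → ℕ} {i : ℕ} (h : ∀ j ≤ i, σ j = σ' j) :
    pending κ ℓ σ i = pending κ ℓ σ' i := by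
  induction i with
  | zero => simp only [pending]; rw [h 0 le_rfl]
  | succ i ih =>
    simp only [pending]
    rw [ih fun j hj => h j (by omega), h _ le_rfl, node_congr h]

lemma update_eq_of_le {σ : ℕ → ℕ} {i k a : ℕ} (h : i < k) :
    ∀ j ≤ i, Function.update σ k a j = σ j := fun j hj => by
  rw [Function.update_of_ne (by omega)]

/-- Fragment 0 selects the first child, and the remaining siblings become pending. The case `i = 0`
also covers the start of the search and each new value of `σ 0`. -/
lemma stack_descend (κ : ℕ) (ℓ σ : ℕ → ℕ) (i : ℕ) :
    (i + 1, node ℓ (Function.update σ (i + 1) 0) (i + 1)) ::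
      pending κ ℓ (Function.update σ (i + 1) 0) (i + 1)
      = children ℓ (i, node ℓ σ i) ++ pending κ ℓ σ i := by
  have h := update_eq_of_le (σ := σ) (a := 0) (Nat.lt_succ_self i)
  have hN : 2 ^ ℓ (i + 1) = (2 ^ ℓ (i + 1) - 1) + 1 :=
    (Nat.sub_add_cancel Nat.one_le_two_pow).symm
  simp only [pending, node, Function.update_self, children]
  rw [pending_congr h, node_congr h]
  conv_rhs => rw [show seg (i + 1) (node ℓ σ i * 2 ^ ℓ (i + 1)) (2 ^ ℓ (i + 1))
    = seg (i + 1) (node ℓ σ i * 2 ^ ℓ (i + 1)) ((2 ^ ℓ (i + 1) - 1) + 1) by rw [← hN], seg_succ]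
  simp

/-- A layer whose fragment is maximal contributes no pending siblings, so the inner loop skips
exactly the empty segments of the stack. -/
lemma pending_backtrack (κ : ℕ) (ℓ σ : ℕ → ℕ) (i : ℕ) (hσ : ∀ j, 1 ≤ j → j ≤ i → σ j < 2 ^ ℓ j) :
    (backtrack ℓ σ i = 0 ∧ pending κ ℓ σ i = pending κ ℓ σ 0) ∨
    ∃ k, 1 ≤ k ∧ k ≤ i ∧ backtrack ℓ σ i = k ∧ σ k + 1 < 2 ^ ℓ k ∧
      pending κ ℓ σ i = (k, node ℓ (Function.update σ k (σ k + 1)) k) ::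
        pending κ ℓ (Function.update σ k (σ k + 1)) k := by
  induction i with
  | zero => left; simp [backtrack]
  | succ i ih =>
    have hlt := hσ (i + 1) (by omega) le_rfl
    by_cases h : σ (i + 1) = 2 ^ ℓ (i + 1) - 1
    · have hp : pending κ ℓ σ (i + 1) = pending κ ℓ σ i := by simp [pending, h]
      rw [hp, show backtrack ℓ σ (i + 1) = backtrack ℓ σ i by simp [backtrack, h]]
      rcases ih fun j h1 h2 => hσ j h1 (by omega) with h' | ⟨k, h1, h2, h3⟩
      · exact Or.inl h'
      · exact Or.inr ⟨k, h1, by omega, h3⟩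
    · refine Or.inr ⟨i + 1, by omega, le_rfl, by simp [backtrack, h], by omega, ?_⟩
      have h' := update_eq_of_le (σ := σ) (a := σ (i + 1) + 1) (Nat.lt_succ_self i)
      simp only [pending, node, Function.update_self]
      rw [pending_congr h', node_congr h',
        show 2 ^ ℓ (i + 1) - 1 - σ (i + 1) = (2 ^ ℓ (i + 1) - 1 - (σ (i + 1) + 1)) + 1 by omega,
        seg_succ]
      simp [add_assoc]

lemma pending_zero_eq (κ : ℕ) (ℓ σ : ℕ → ℕ) :
    (¬ σ 0 + 1 < 2 ^ κ ∧ pending κ ℓ σ 0 = []) ∨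
    (σ 0 + 1 < 2 ^ κ ∧ pending κ ℓ σ 0 =
      (1, node ℓ (Function.update (Function.update σ 0 (σ 0 + 1)) 1 0) 1) ::
        pending κ ℓ (Function.update (Function.update σ 0 (σ 0 + 1)) 1 0) 1) := by
  by_cases h : σ 0 + 1 < 2 ^ κ
  · refine Or.inr ⟨h, ?_⟩
    have hd := stack_descend κ ℓ (Function.update σ 0 (σ 0 + 1)) 0
    rw [zero_add] at hd
    rw [hd]
    simp only [pending, children, node, Function.update_self, zero_add]
    obtain ⟨d, hd⟩ := Nat.exists_eq_add_of_lt h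
    rw [show 2 ^ κ - (σ 0 + 1) = 1 + d by omega, show 2 ^ κ - (σ 0 + 1 + 1) = d by omega,
      add_mul 1 d, seg_append, one_mul, add_mul (σ 0 + 1) 1, one_mul]
  · exact Or.inl ⟨h, by simp [pending, Nat.sub_eq_zero_of_le (not_lt.mp h)]⟩

/-- The fragments are in range and the seeds chosen before layer `i` are successful. -/
structure Valid (n κ w : ℕ) (ℓ : ℕ → ℕ) (b : ℕ → ℕ → Bool) (i : ℕ) (σ : ℕ → ℕ) : Prop where
  one_le : 1 ≤ i
  le : i ≤ n
  root_lt : σ 0 < 2 ^ κ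
  lt : ∀ j, 1 ≤ j → j ≤ i → σ j < 2 ^ ℓ j
  success : ∀ j, 1 ≤ j → j < i → b j (seed w ℓ σ j) = true

lemma seed_congr {w : ℕ} {ℓ σ σ' : ℕ → ℕ} {i : ℕ} (h : ∀ j ≤ i, σ j = σ' j) :
    seed w ℓ σ i = seed w ℓ σ' i := by
  rw [seed, seed, node_congr h]

/-! ### The machine follows the stack search -/

section Machine

variable {n κ w : ℕ} {ℓ : ℕ → ℕ} {b : ℕ → ℕ → Bool} {i : ℕ} {σ : ℕ → ℕ}

lemma Valid.step_true (h : Valid n κ w ℓ b i σ) (hb : b i (seed w ℓ σ i) = true) (hi : i ≠ n) :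
    ∃ σ', step n w ℓ b (.search i σ) = .search (i + 1) σ' ∧ Valid n κ w ℓ b (i + 1) σ' ∧
      (i + 1, node ℓ σ' (i + 1)) :: pending κ ℓ σ' (i + 1)
        = children ℓ (i, node ℓ σ i) ++ pending κ ℓ σ i := by
  have hu := update_eq_of_le (σ := σ) (a := 0) (Nat.lt_succ_self i)
  refine ⟨Function.update σ (i + 1) 0, by simp [step, hb, hi], ?_, stack_descend ..⟩
  refine ⟨by omega, by have := h.le; omega, ?_, fun j h1 h2 => ?_, fun j h1 h2 => ?_⟩
  · rw [hu 0 (by omega)]; exact h.root_lt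
  · rcases Nat.lt_or_ge i j with hj | hj
    · obtain rfl : j = i + 1 := by omega
      simp
    · rw [hu j hj]; exact h.lt j h1 hj
  · rw [seed_congr fun k hk => hu k (by omega)]
    rcases Nat.lt_or_ge j i with hj | hj
    · exact h.success j h1 hj
    · obtain rfl : j = i := by omega
      exact hb

/-- In the first alternative the stack restricted to `σ 0 < 2 ^ κ` is used up, although the machine
may continue with larger values. That case is incompatible with `FreshSuccess`. -/
lemma Valid.step_false (h : Valid n κ w ℓ b i σ) (hκ : κ ≤ w) (hb : b i (seed w ℓ σ i) ≠ true) :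
    pending κ ℓ σ i = [] ∨
    ∃ k σ', step n w ℓ b (.search i σ) = .search k σ' ∧ Valid n κ w ℓ b k σ' ∧
      (k, node ℓ σ' k) :: pending κ ℓ σ' k = pending κ ℓ σ i := by
  rcases pending_backtrack κ ℓ σ i h.lt with ⟨h0, hp⟩ | ⟨k, h1, hk, hbt, hlt, hp⟩
  · rcases pending_zero_eq κ ℓ σ with ⟨-, h2⟩ | ⟨h1, h2⟩
    · exact Or.inl (hp.trans h2)
    · have hw : σ 0 + 1 < 2 ^ w := h1.trans_le (Nat.pow_le_pow_right (by norm_num) hκ)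
      refine Or.inr ⟨1, _, ?_, ?_, (hp.trans h2).symm⟩
      · simp [step, hb, h0, hw]
      · refine ⟨le_rfl, h.one_le.trans h.le, ?_, fun j h1 h2 => ?_, fun j _ _ => by omega⟩
        · rwa [Function.update_of_ne (by norm_num), Function.update_self]
        · obtain rfl : j = 1 := by omega
          simp
  · refine Or.inr ⟨k, Function.update σ k (σ k + 1), ?_, ?_, hp.symm⟩
    · simp [step, hb, hbt, Nat.lt_of_lt_of_le Nat.zero_lt_one h1]
    · have hu : ∀ j, j < k → Function.update σ k (σ k + 1) j = σ j := fun j hj => by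
        rw [Function.update_of_ne (by omega)]
      refine ⟨h1, hk.trans h.le, ?_, fun j hj1 hj2 => ?_, fun j hj1 hj2 => ?_⟩
      · rw [hu 0 (by omega)]; exact h.root_lt
      · rcases Nat.lt_or_ge j k with hj | hj
        · rw [hu j hj]; exact h.lt j hj1 (by omega)
        · obtain rfl : j = k := by omega
          rwa [Function.update_self]
      · rw [seed_congr fun a ha => hu a (by omega)]
        exact h.success j hj1 (by omega)

/-- The number of inspections in layer `i` when the machine is started in configuration `c`. -/
noncomputable def trialsFrom (n w : ℕ) (ℓ : ℕ → ℕ) (b : ℕ → ℕ → Bool) (i : ℕ) (c : Config) : ℕ∞ :=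
  Set.encard {t : ℕ | ∃ σ, (step n w ℓ b)^[t] c = .search i σ}

lemma trialsFrom_le (i : ℕ) (c : Config) (e : ℕ) (hc : (∃ σ, c = .search i σ) → 1 ≤ e) :
    trialsFrom n w ℓ b i c ≤ e + trialsFrom n w ℓ b i (step n w ℓ b c) := by
  have hsub : {t : ℕ | ∃ σ, (step n w ℓ b)^[t] c = .search i σ} ⊆
      {t | t = 0 ∧ ∃ σ, c = .search i σ} ∪
        Nat.succ '' {t : ℕ | ∃ σ, (step n w ℓ b)^[t] (step n w ℓ b c) = .search i σ} := by
    rintro (_ | t) ht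
    · exact Or.inl ⟨rfl, ht⟩
    · exact Or.inr ⟨t, by simpa using ht, rfl⟩
  refine (Set.encard_le_encard hsub).trans ((Set.encard_union_le _ _).trans ?_)
  refine add_le_add ?_ (Nat.succ_injective.encard_image _).le
  by_cases h : ∃ σ, c = .search i σ
  · refine (Set.encard_le_encard (t := {0}) fun t ht => ht.1).trans ?_
    rw [Set.encard_singleton]
    exact_mod_cast hc h
  · simp [h]

lemma trialsFrom_found (i : ℕ) (σ : ℕ → ℕ) : trialsFrom n w ℓ b i (.found σ) = 0 := by
  have : ∀ t, (step n w ℓ b)^[t] (.found σ) = .found σ := fun t =>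
    Function.iterate_fixed rfl t
  simp [trialsFrom, this]

/-- The current node followed by its pending nodes is the stack, and each machine step performs one
stack step. The set `H` does not influence the machine; under `FreshSuccess` the cut-off in
`freshCount` never occurs. -/
lemma Valid.returns_of_freshSuccess (hκ : κ ≤ w) (t : ℕ) :
    ∀ (H : Finset (ℕ × ℕ)) (i : ℕ) (σ : ℕ → ℕ), Valid n κ w ℓ b i σ →
      FreshSuccess n w ℓ b t H ((i, node ℓ σ i) :: pending κ ℓ σ i) →
      (∃ t' σ', (step n w ℓ b)^[t'] (.search i σ) = .found σ' ∧ Valid n κ w ℓ b n σ' ∧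
        b n (seed w ℓ σ' n) = true) ∧
      ∀ k, trialsFrom n w ℓ b k (.search i σ)
        ≤ (freshCount n w ℓ b k t H ((i, node ℓ σ i) :: pending κ ℓ σ i) : ℕ) := by
  induction t with
  | zero => intro H i σ _ h; exact h.elim
  | succ t ih =>
    intro H i σ hv h
    simp only [FreshSuccess] at h
    obtain ⟨hH, h⟩ := h
    have hcount : ∀ k, (∃ σ', Config.search i σ = .search k σ') →
        1 ≤ (if i = k then 1 else 0) := by
      rintro k ⟨σ', h⟩
      injection h with h1 h2
      simp [h1]
    have hgo : ∀ (i' : ℕ) (σ' : ℕ → ℕ) (s : List (ℕ × ℕ)),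
        step n w ℓ b (.search i σ) = .search i' σ' → Valid n κ w ℓ b i' σ' →
        (i', node ℓ σ' i') :: pending κ ℓ σ' i' = s →
        FreshSuccess n w ℓ b t (insert (label w (i, node ℓ σ i)) H) s →
        (∃ t' σ', (step n w ℓ b)^[t'] (.search i σ) = .found σ' ∧ Valid n κ w ℓ b n σ' ∧
          b n (seed w ℓ σ' n) = true) ∧
        ∀ k, trialsFrom n w ℓ b k (.search i σ) ≤ ((if i = k then 1 else 0) +
          freshCount n w ℓ b k t (insert (label w (i, node ℓ σ i)) H) s : ℕ) := by
      rintro i' σ' s hs hv' rfl hF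
      obtain ⟨⟨t', σ'', h1, h2⟩, h3⟩ := ih _ i' σ' hv' hF
      refine ⟨⟨t' + 1, σ'', by rw [Function.iterate_succ_apply, hs, h1], h2⟩, fun k => ?_⟩
      refine (trialsFrom_le k _ _ (hcount k)).trans ?_
      rw [hs]
      push_cast
      exact add_le_add (by simp) (h3 k)
    simp only [freshCount, hH, if_false]
    by_cases hb : b i (node ℓ σ i % 2 ^ w) = true
    · simp only [hb, if_true] at h ⊢
      by_cases hi : i = n
      · subst hi
        have hs : step i w ℓ b (.search i σ) = .found σ := by simp [step, seed, hb]
        refine ⟨⟨1, σ, by simpa using hs, hv, hb⟩, fun k => ?_⟩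
        refine (trialsFrom_le k _ _ (hcount k)).trans ?_
        rw [hs, trialsFrom_found]
        simp
      · simp only [hi, if_false, false_or] at h ⊢
        obtain ⟨σ', h1, h2, h3⟩ := hv.step_true hb hi
        exact hgo _ σ' _ h1 h2 h3 h
    · simp only [hb] at h ⊢
      rcases hv.step_false hκ hb with h0 | ⟨k, σ', h1, h2, h3⟩
      · rw [h0] at h
        cases t <;> exact h.elim
      · exact hgo k σ' _ h1 h2 h3 h

end Machine

lemma initial_stack (κ : ℕ) (ℓ : ℕ → ℕ) :
    (1, node ℓ (fun _ => 0) 1) :: pending κ ℓ (fun _ => 0) 1 = seg 1 0 (2 ^ κ * 2 ^ ℓ 1) := by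
  have h := stack_descend κ ℓ (fun _ => 0) 0
  rw [zero_add, Function.update_eq_self_iff.mpr rfl] at h
  rw [h]
  simp only [children, node, pending, zero_add, zero_mul, one_mul]
  have h1 : 2 ^ κ = 1 + (2 ^ κ - 1) := (Nat.add_sub_cancel' Nat.one_le_two_pow).symm
  conv_rhs => rw [h1, add_mul, seg_append]
  simp

lemma run_of_freshSuccess {n κ w : ℕ} {ℓ : ℕ → ℕ} {b : ℕ → ℕ → Bool} {t : ℕ} (hn : 1 ≤ n)
    (hκ : κ ≤ w) (h : FreshSuccess n w ℓ b t ∅ (seg 1 0 (2 ^ κ * 2 ^ ℓ 1))) :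
    (∃ σ, Returns n w ℓ b σ ∧ Valid n κ w ℓ b n σ ∧ b n (seed w ℓ σ n) = true) ∧
    ∀ i, trials n w ℓ b i
      ≤ (freshCount n w ℓ b i t ∅ (seg 1 0 (2 ^ κ * 2 ^ ℓ 1)) : ℕ) := by
  rw [← initial_stack] at h ⊢
  have hv : Valid n κ w ℓ b 1 (fun _ => 0) :=
    ⟨le_rfl, hn, by simp, fun _ _ _ => by simp, fun j _ _ => by omega⟩
  obtain ⟨⟨t', σ, h1, h2, h3⟩, h4⟩ := hv.returns_of_freshSuccess hκ t _ _ _ h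
  exact ⟨⟨σ, ⟨t', h1⟩, h2, h3⟩, h4⟩

/-! ### The returned bitstring -/

@[simp] lemma length_toBits (k m : ℕ) : (toBits k m).length = k := by simp [toBits]

lemma toBits_append (a b x y : ℕ) (hy : y < 2 ^ b) :
    toBits (a + b) (x * 2 ^ b + y) = toBits a x ++ toBits b y := by
  apply List.ext_getElem (by simp)
  intro i h1 h2
  simp only [length_toBits] at h1
  rw [List.getElem_append]
  simp only [toBits, List.getElem_ofFn, List.length_ofFn]
  rw [mul_comm, Nat.testBit_two_pow_mul_add _ hy]
  split_ifs with h3 h4 h4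
  · omega
  · congr 1; omega
  · congr 1; omega
  · omega

lemma ofBits_concat (l : List Bool) (x : Bool) : ofBits (l ++ [x]) = 2 * ofBits l + x.toNat := by
  simp [ofBits]

lemma ofBits_toBits (k m : ℕ) : ofBits (toBits k m) = m % 2 ^ k := by
  induction k generalizing m with
  | zero => simp [toBits, ofBits, Nat.mod_one]
  | succ k ih =>
    have h := toBits_append k 1 (m / 2) (m % 2) (by omega)
    rw [pow_one, Nat.div_add_mod' m 2] at h
    have h1 : toBits 1 (m % 2) = [m.testBit 0] := by simp [toBits]
    rw [h, h1, ofBits_concat, ih, Nat.pow_succ', Nat.mod_mul]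
    rw [Nat.testBit_zero]
    rcases Nat.mod_two_eq_zero_or_one m with h | h <;> simp [h, add_comm]

lemma offset_succ (ℓ : ℕ → ℕ) (i : ℕ) : offset ℓ (i + 1) = offset ℓ i + ℓ (i + 1) := by
  rw [offset, offset, Finset.sum_Icc_succ_top (by omega)]

@[simp] lemma offset_zero (ℓ : ℕ → ℕ) : offset ℓ 0 = 0 := by simp [offset]

lemma encode_succ (n w : ℕ) (ℓ σ : ℕ → ℕ) :
    encode (n + 1) w ℓ σ = encode n w ℓ σ ++ toBits (ℓ (n + 1)) (σ (n + 1)) := by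
  simp [encode, List.range_succ, List.flatMap_append]

lemma length_encode (n w : ℕ) (ℓ σ : ℕ → ℕ) : (encode n w ℓ σ).length = w + offset ℓ n := by
  induction n with
  | zero => simp [encode]
  | succ n ih => rw [encode_succ, List.length_append, ih, length_toBits, offset_succ, add_assoc]

lemma encode_eq_toBits (n w : ℕ) (ℓ σ : ℕ → ℕ) (h : ∀ j, 1 ≤ j → j ≤ n → σ j < 2 ^ ℓ j) :
    encode n w ℓ σ = toBits (w + offset ℓ n) (node ℓ σ n) := by
  induction n with
  | zero => simp [encode, node]
  | succ n ih =>
    rw [encode_succ, ih fun j h1 h2 => h j h1 (by omega), offset_succ, ← add_assoc, node,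
      toBits_append _ _ _ _ (h (n + 1) (by omega) le_rfl)]

lemma encode_prefix {i n : ℕ} (hi : i ≤ n) (w : ℕ) (ℓ σ : ℕ → ℕ) :
    encode i w ℓ σ <+: encode n w ℓ σ := by
  induction n, hi using Nat.le_induction with
  | base => exact List.prefix_refl _
  | succ n _ ih => rw [encode_succ]; exact ih.trans (List.prefix_append _ _)

/-- The prefix of the encoding up to fragment `i` is the binary representation of `node ℓ σ i` with
`w + offset ℓ i` bits. Its last `w` bits start at position `offset ℓ i` and represent the residue
modulo `2 ^ w`. -/
lemma window_encode {i n : ℕ} (hi : i ≤ n) (w : ℕ) (ℓ σ : ℕ → ℕ)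
    (h : ∀ j, 1 ≤ j → j ≤ n → σ j < 2 ^ ℓ j) :
    window w (encode n w ℓ σ) (offset ℓ i) = toBits w (seed w ℓ σ i) := by
  obtain ⟨r, hr⟩ := encode_prefix hi w ℓ σ
  have h1 := encode_eq_toBits i w ℓ σ fun j h1 h2 => h j h1 (by omega)
  have h2 := toBits_append (offset ℓ i) w (node ℓ σ i / 2 ^ w) (node ℓ σ i % 2 ^ w)
    (Nat.mod_lt _ (by positivity))
  rw [Nat.div_add_mod', add_comm, ← h1] at h2
  rw [window, ← hr, h2, List.append_assoc, List.drop_left' (length_toBits _ _),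
    List.take_left' (length_toBits _ _), seed]

lemma solvesSSEP_encode {n κ w : ℕ} {ℓ : ℕ → ℕ} {b : ℕ → ℕ → Bool} {σ : ℕ → ℕ}
    (h : Valid n κ w ℓ b n σ) (hn : b n (seed w ℓ σ n) = true) :
    SolvesSSEP n b (fun M i => ofBits (window w M (offset ℓ i))) (encode n w ℓ σ) := by
  intro i hi
  rw [Finset.mem_Icc] at hi
  simp only
  rw [window_encode hi.2 w ℓ σ h.lt, ofBits_toBits, seed, Nat.mod_mod, ← seed]
  rcases hi.2.lt_or_eq with hlt | rfl
  · exact h.success i hi.1 hlt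
  · exact hn

/-! ### Success probabilities of subtrees -/

/-- The probability, when every node has its own variable, that a node of layer `m` is successful
and has a successful path to layer `n`. -/
noncomputable def nodeProb (n : ℕ) (ℓ : ℕ → ℕ) (p : ℕ → ℝ) (m : ℕ) : ℝ :=
  if n < m then 1 else p m * (1 - (1 - nodeProb n ℓ p (m + 1)) ^ 2 ^ ℓ (m + 1))
termination_by n + 1 - m

section NodeProb

variable {n : ℕ} {ℓ : ℕ → ℕ} {p : ℕ → ℝ}

lemma nodeProb_of_lt {m : ℕ} (h : n < m) : nodeProb n ℓ p m = 1 := by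
  rw [nodeProb, if_pos h]

lemma nodeProb_of_le {m : ℕ} (h : m ≤ n) :
    nodeProb n ℓ p m = p m * (1 - (1 - nodeProb n ℓ p (m + 1)) ^ 2 ^ ℓ (m + 1)) := by
  rw [nodeProb, if_neg h.not_gt]

lemma nodeProb_mem (hp : ∀ j, 0 < p j ∧ p j ≤ 1) (m : ℕ) :
    0 < nodeProb n ℓ p m ∧ nodeProb n ℓ p m ≤ 1 := by
  obtain ⟨d, hd⟩ : ∃ d, d = n + 1 - m := ⟨_, rfl⟩
  induction d generalizing m with
  | zero => rw [nodeProb_of_lt (by omega)]; norm_num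
  | succ d ih =>
    obtain ⟨h0, h1⟩ := ih (m + 1) (by omega)
    rw [nodeProb_of_le (by omega)]
    have h2 : (1 - nodeProb n ℓ p (m + 1)) ^ 2 ^ ℓ (m + 1) < 1 :=
      pow_lt_one₀ (by linarith) (by linarith) (by positivity)
    have h3 : 0 ≤ (1 - nodeProb n ℓ p (m + 1)) ^ 2 ^ ℓ (m + 1) := pow_nonneg (by linarith) _
    exact ⟨mul_pos (hp m).1 (by linarith),
      mul_le_one₀ (hp m).2 (by linarith) (by linarith)⟩

lemma nodeProb_le (hp : ∀ j, 0 < p j ∧ p j ≤ 1) {m : ℕ} (h : m ≤ n) : nodeProb n ℓ p m ≤ p m := by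
  rw [nodeProb_of_le h]
  have := pow_nonneg (sub_nonneg.mpr (nodeProb_mem (n := n) (ℓ := ℓ) hp (m + 1)).2) (2 ^ ℓ (m + 1))
  exact mul_le_of_le_one_right (hp m).1.le (by linarith)

end NodeProb

/-! ### Weighted sums along the stack -/

/-- The probability that all nodes of the stack fail, when a node of layer `m` succeeds with
probability `q m`. -/
def failProb (q : ℕ → ℝ) (s : List (ℕ × ℕ)) : ℝ := (s.map fun y => 1 - q y.1).prod

/-- The sum of the weights of the nodes of the stack, up to the first successful one, in
expectation. -/
def stackSum (q : ℕ → ℝ) (f : ℕ × ℕ → ℝ) : List (ℕ × ℕ) → ℝ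
  | [] => 0
  | y :: s => f y + (1 - q y.1) * stackSum q f s

section StackSum

variable {q : ℕ → ℝ} {f : ℕ × ℕ → ℝ}

@[simp] lemma failProb_nil : failProb q [] = 1 := rfl

lemma failProb_cons (y : ℕ × ℕ) (s : List (ℕ × ℕ)) :
    failProb q (y :: s) = (1 - q y.1) * failProb q s := by simp [failProb]

lemma failProb_append (l s : List (ℕ × ℕ)) :
    failProb q (l ++ s) = failProb q l * failProb q s := by simp [failProb]

lemma failProb_seg (m v k : ℕ) : failProb q (seg m v k) = (1 - q m) ^ k := by
  induction k generalizing v with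
  | zero => simp
  | succ k ih => rw [seg_succ, failProb_cons, ih, pow_succ']

lemma failProb_nonneg (hq : ∀ m, q m ≤ 1) (s : List (ℕ × ℕ)) : 0 ≤ failProb q s :=
  List.prod_nonneg fun x hx => by
    obtain ⟨y, -, rfl⟩ := List.mem_map.mp hx
    exact sub_nonneg.mpr (hq _)

lemma stackSum_append (l s : List (ℕ × ℕ)) :
    stackSum q f (l ++ s) = stackSum q f l + failProb q l * stackSum q f s := by
  induction l with
  | nil => simp [stackSum]
  | cons y l ih => rw [List.cons_append, stackSum, ih, stackSum, failProb_cons]; ring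

lemma stackSum_nonneg (hq : ∀ m, q m ≤ 1) (hf : ∀ y, 0 ≤ f y) (s : List (ℕ × ℕ)) :
    0 ≤ stackSum q f s := by
  induction s with
  | nil => exact le_rfl
  | cons y s ih => exact add_nonneg (hf y) (mul_nonneg (sub_nonneg.mpr (hq _)) ih)

lemma stackSum_eq_zero (s : List (ℕ × ℕ)) (h : ∀ y ∈ s, f y = 0) : stackSum q f s = 0 := by
  induction s with
  | nil => rfl
  | cons y s ih =>
    rw [stackSum, h y (by simp), ih fun z hz => h z (by simp [hz])]; ring

/-- A geometric series: up to the first success among `k` trials, the expected number of trials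
times `q m` is the probability of a success. Multiplying by `q m` avoids a division. -/
lemma stackSum_seg {g : ℕ → ℝ} (m v k : ℕ) :
    q m * stackSum q (fun y => g y.1) (seg m v k) = g m * (1 - (1 - q m) ^ k) := by
  induction k generalizing v with
  | zero => simp [stackSum]
  | succ k ih =>
    rw [seg_succ, stackSum, mul_add, mul_left_comm, ih]; ring

end StackSum

/-- The expectation of `F` after inspecting `y` on top of the stack `s`, if the variable of `y`
is independent of the past. -/
def stepMean (ℓ : ℕ → ℕ) (p : ℕ → ℝ) (F : List (ℕ × ℕ) → ℝ) (y : ℕ × ℕ) (s : List (ℕ × ℕ)) : ℝ :=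
  p y.1 * F (children ℓ y ++ s) + (1 - p y.1) * F s

section StepMean

variable {n : ℕ} {ℓ : ℕ → ℕ} {p : ℕ → ℝ} {y : ℕ × ℕ}

lemma failProb_children (hy : y.1 ≤ n) :
    p y.1 * failProb (nodeProb n ℓ p) (children ℓ y) + (1 - p y.1) = 1 - nodeProb n ℓ p y.1 := by
  rw [children, failProb_seg, nodeProb_of_le hy]; ring

lemma stepMean_failProb (hy : y.1 ≤ n) (s : List (ℕ × ℕ)) :
    stepMean ℓ p (failProb (nodeProb n ℓ p)) y s = failProb (nodeProb n ℓ p) (y :: s) := by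
  rw [stepMean, failProb_append, failProb_cons, ← failProb_children hy]; ring

/-- The tail `s` is reached with probability `1 - q y.1` both before and after the inspection, so
its contribution cancels and only a local condition at `y` remains. -/
lemma stepMean_stackSum_le (hy : y.1 ≤ n) {f : ℕ × ℕ → ℝ} {e : ℝ} (s : List (ℕ × ℕ))
    (h : e + p y.1 * stackSum (nodeProb n ℓ p) f (children ℓ y) ≤ f y) :
    e + stepMean ℓ p (stackSum (nodeProb n ℓ p) f) y s
      ≤ stackSum (nodeProb n ℓ p) f (y :: s) := by
  rw [stepMean, stackSum_append, stackSum, ← failProb_children hy]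
  linarith

end StepMean

/-! ### Descendants -/

/-- The number of bits by which the indices of layer `i` exceed those of layer `m`. -/
def depth (ℓ : ℕ → ℕ) (m i : ℕ) : ℕ := offset ℓ i - offset ℓ m

/-- The descendants in layer `i` of the nodes `v, …, v + k - 1` of layer `m`. -/
def descendants (ℓ : ℕ → ℕ) (i m v k : ℕ) : Finset ℕ :=
  Finset.Ico (v * 2 ^ depth ℓ m i) ((v + k) * 2 ^ depth ℓ m i)

/-- The probability that all nodes of a path from layer `m` to layer `i - 1` are successful. -/
def pathProb (p : ℕ → ℝ) (m i : ℕ) : ℝ := ∏ j ∈ Finset.Ico m i, p j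

/-- The probability that a path from layer `m` to layer `i` is inspected while the subtree of its
first node fails. -/
def pathFailProb (ℓ : ℕ → ℕ) (p q : ℕ → ℝ) (m i : ℕ) : ℝ :=
  pathProb p m i * (1 - q i) * ∏ j ∈ Finset.Ico (m + 1) (i + 1), (1 - q j) ^ (2 ^ ℓ j - 1)

section Descendants

variable {ℓ : ℕ → ℕ} {p q : ℕ → ℝ}

@[simp] lemma depth_self (i : ℕ) : depth ℓ i i = 0 := by simp [depth]

lemma offset_mono (ℓ : ℕ → ℕ) : Monotone (offset ℓ) :=
  monotone_nat_of_le_succ fun i => by rw [offset_succ]; omega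

lemma depth_of_lt {m i : ℕ} (h : m < i) : depth ℓ m i = ℓ (m + 1) + depth ℓ (m + 1) i := by
  have h1 := offset_mono ℓ (Nat.succ_le_of_lt h)
  have h2 := offset_succ ℓ m
  simp only [depth, Nat.succ_eq_add_one] at *
  omega

lemma descendants_children {m i : ℕ} (h : m < i) (v : ℕ) :
    descendants ℓ i (m + 1) (v * 2 ^ ℓ (m + 1)) (2 ^ ℓ (m + 1)) = descendants ℓ i m v 1 := by
  rw [descendants, descendants, depth_of_lt h, pow_add]
  congr 1 <;> ring

@[simp] lemma descendants_zero (i m v : ℕ) : descendants ℓ i m v 0 = ∅ := by simp [descendants]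

@[simp] lemma descendants_self (i v : ℕ) : descendants ℓ i i v 1 = {v} := by simp [descendants]

lemma card_descendants (i m v k : ℕ) : (descendants ℓ i m v k).card = k * 2 ^ depth ℓ m i := by
  rw [descendants, Nat.card_Ico, ← Nat.sub_mul]; simp

lemma descendants_succ (i m v k : ℕ) :
    descendants ℓ i m v 1 ∪ descendants ℓ i m (v + 1) k = descendants ℓ i m v (k + 1) := by
  rw [descendants, descendants, descendants, Finset.Ico_union_Ico_eq_Ico
    (Nat.mul_le_mul_right _ (by omega)) (Nat.mul_le_mul_right _ (by omega)), add_assoc, add_comm 1]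

lemma disjoint_descendants (i m v k : ℕ) :
    Disjoint (descendants ℓ i m v 1) (descendants ℓ i m (v + 1) k) :=
  Finset.Ico_disjoint_Ico_consecutive _ _ _

@[simp] lemma pathProb_self (i : ℕ) : pathProb p i i = 1 := by simp [pathProb]

lemma pathProb_of_lt {m i : ℕ} (h : m < i) : pathProb p m i = p m * pathProb p (m + 1) i :=
  Finset.prod_eq_prod_Ico_succ_bot h _

lemma pathFailProb_self (i : ℕ) : pathFailProb ℓ p q i i = 1 - q i := by simp [pathFailProb]

lemma pathFailProb_of_lt {m i : ℕ} (h : m < i) : pathFailProb ℓ p q m i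
    = p m * (1 - q (m + 1)) ^ (2 ^ ℓ (m + 1) - 1) * pathFailProb ℓ p q (m + 1) i := by
  rw [pathFailProb, pathProb_of_lt h, Finset.prod_eq_prod_Ico_succ_bot (by omega), pathFailProb]
  ring

lemma pathProb_nonneg (hp : ∀ j, 0 < p j) (m i : ℕ) : 0 ≤ pathProb p m i :=
  Finset.prod_nonneg fun j _ => (hp j).le

lemma pathFailProb_nonneg (hp : ∀ j, 0 < p j) (hq : ∀ j, q j ≤ 1) (m i : ℕ) :
    0 ≤ pathFailProb ℓ p q m i :=
  mul_nonneg (mul_nonneg (pathProb_nonneg hp m i) (sub_nonneg.mpr (hq i)))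
    (Finset.prod_nonneg fun j _ => pow_nonneg (sub_nonneg.mpr (hq j)) _)

/-! ### The AM-GM estimate for pairs of paths -/

/-- The arithmetic mean of `1, x, …, x ^ (N - 1)` is at least their geometric mean. -/
lemma sq_mul_pow_le_sq_geom_sum {x : ℝ} (hx : 0 ≤ x) (N : ℕ) :
    (N : ℝ) ^ 2 * x ^ (N - 1) ≤ (∑ k ∈ Finset.range N, x ^ k) ^ 2 := by
  -- Passing to a square root makes the geometric mean the integral power `y ^ (N - 1)`; AM-GM is
  -- then applied to each pair of terms `k` and `N - 1 - k`.
  obtain ⟨y, hy, rfl⟩ : ∃ y : ℝ, 0 ≤ y ∧ x = y ^ 2 := ⟨√x, Real.sqrt_nonneg x, (Real.sq_sqrt hx).symm⟩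
  have h : (N : ℝ) * y ^ (N - 1) ≤ ∑ k ∈ Finset.range N, (y ^ 2) ^ k := by
    have h1 : 2 * ∑ k ∈ Finset.range N, (y ^ 2) ^ k
        = ∑ k ∈ Finset.range N, ((y ^ 2) ^ k + (y ^ 2) ^ (N - 1 - k)) := by
      rw [Finset.sum_add_distrib, Finset.sum_range_reflect (fun k => (y ^ 2) ^ k) N, two_mul]
    have h2 : (N : ℝ) * (2 * y ^ (N - 1))
        ≤ ∑ k ∈ Finset.range N, ((y ^ 2) ^ k + (y ^ 2) ^ (N - 1 - k)) := by
      have h := Finset.card_nsmul_le_sum (Finset.range N)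
        (fun k => (y ^ 2) ^ k + (y ^ 2) ^ (N - 1 - k)) (2 * y ^ (N - 1)) fun k hk => ?_
      · rwa [Finset.card_range, nsmul_eq_mul] at h
      rw [Finset.mem_range] at hk
      have h3 : y ^ (N - 1) = y ^ k * y ^ (N - 1 - k) := by rw [← pow_add]; congr 1; omega
      rw [h3, pow_right_comm y 2 k, pow_right_comm y 2]
      nlinarith [sq_nonneg (y ^ k - y ^ (N - 1 - k))]
    linarith
  calc (N : ℝ) ^ 2 * (y ^ 2) ^ (N - 1) = (N * y ^ (N - 1)) ^ 2 := by ring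
    _ ≤ _ := pow_le_pow_left₀ (by positivity) h 2

lemma sq_mul_sq_mul_pow_le {u : ℝ} (h1 : u ≤ 1) (N : ℕ) :
    (N : ℝ) ^ 2 * u ^ 2 * (1 - u) ^ (N - 1) ≤ (1 - (1 - u) ^ N) ^ 2 := by
  have h := sq_mul_pow_le_sq_geom_sum (sub_nonneg.mpr h1) N
  have hg := mul_neg_geom_sum (1 - u) N
  rw [← hg, mul_pow, sub_sub_cancel]
  nlinarith [sq_nonneg u]

/-- Here `4 ^ depth` counts pairs of descendants of two nodes of layer `m`; the earlier subtree
fails, the later path is merely inspected. Moving up one layer costs a factor `p m ^ 2 * N ^ 2 * (1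
- q (m + 1)) ^ (N - 1)` with `N = 2 ^ ℓ (m + 1)`, and by `sq_mul_sq_mul_pow_le` this is at most `(q
m / q (m + 1)) ^ 2`. -/
lemma four_pow_mul_pathFailProb_mul_pathProb_le {n : ℕ} (hp : ∀ j, 0 < p j ∧ p j ≤ 1) {m i : ℕ}
    (hm : m ≤ i) (hi : i ≤ n) :
    4 ^ depth ℓ m i * (pathFailProb ℓ p (nodeProb n ℓ p) m i * pathProb p m i)
      * nodeProb n ℓ p i ^ 2 ≤ nodeProb n ℓ p m ^ 2 := by
  induction hm using Nat.decreasingInduction with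
  | self =>
    have := nodeProb_mem (n := n) (ℓ := ℓ) hp i
    rw [depth_self, pathFailProb_self, pathProb_self]
    nlinarith [sq_nonneg (nodeProb n ℓ p i)]
  | of_succ m h ih =>
    have hq := nodeProb_mem (n := n) (ℓ := ℓ) hp (m + 1)
    have hk := sq_mul_sq_mul_pow_le hq.2 (2 ^ ℓ (m + 1))
    rw [depth_of_lt h, pathFailProb_of_lt h, pathProb_of_lt h,
      nodeProb_of_le (m := m) (by omega)]
    set q := nodeProb n ℓ p
    set E := pathFailProb ℓ p q (m + 1) i
    set P := pathProb p (m + 1) i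
    have h4 : (4 : ℝ) ^ ℓ (m + 1) = (2 ^ ℓ (m + 1)) ^ 2 := by
      rw [← pow_mul, mul_comm, pow_mul]; norm_num
    push_cast at hk
    calc (4 : ℝ) ^ (ℓ (m + 1) + depth ℓ (m + 1) i) *
          (p m * (1 - q (m + 1)) ^ (2 ^ ℓ (m + 1) - 1) * E * (p m * P)) * q i ^ 2
        = p m ^ 2 * ((2 ^ ℓ (m + 1)) ^ 2 * (1 - q (m + 1)) ^ (2 ^ ℓ (m + 1) - 1)) *
          (4 ^ depth ℓ (m + 1) i * (E * P) * q i ^ 2) := by rw [pow_add, h4]; ring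
      _ ≤ p m ^ 2 * ((2 ^ ℓ (m + 1)) ^ 2 * (1 - q (m + 1)) ^ (2 ^ ℓ (m + 1) - 1)) *
          q (m + 1) ^ 2 := by
        have := pow_nonneg (sub_nonneg.mpr hq.2) (2 ^ ℓ (m + 1) - 1)
        gcongr
      _ = p m ^ 2 * ((2 ^ ℓ (m + 1)) ^ 2 * q (m + 1) ^ 2 *
          (1 - q (m + 1)) ^ (2 ^ ℓ (m + 1) - 1)) := by ring
      _ ≤ p m ^ 2 * (1 - (1 - q (m + 1)) ^ 2 ^ ℓ (m + 1)) ^ 2 := by gcongr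
      _ = _ := by ring

end Descendants

/-! ### The expected number of inspections of a variable -/

/-- A bound on the expected number of inspections of the variable `a` in the subtree of `y`. -/
def hitWeight (w : ℕ) (ℓ : ℕ → ℕ) (p : ℕ → ℝ) (a y : ℕ × ℕ) : ℝ :=
  if y.1 ≤ a.1 then
    pathProb p y.1 a.1 * ({u ∈ descendants ℓ a.1 y.1 y.2 1 | u % 2 ^ w = a.2}.card : ℝ) else 0

section Hits

variable {n w : ℕ} {ℓ : ℕ → ℕ} {p q : ℕ → ℝ}

lemma hitWeight_nonneg (hp : ∀ j, 0 < p j) (a y : ℕ × ℕ) : 0 ≤ hitWeight w ℓ p a y := by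
  rw [hitWeight]
  split_ifs
  · exact mul_nonneg (pathProb_nonneg hp _ _) (Nat.cast_nonneg _)
  · exact le_rfl

/-- The factors `1 - q m` for the failure of earlier nodes are bounded by 1; what remains is a union
over disjoint intervals of descendants. -/
lemma stackSum_hitWeight_seg_le (hp : ∀ j, 0 < p j) (hq : ∀ j, 0 ≤ q j ∧ q j ≤ 1) {i m : ℕ}
    (hm : m ≤ i) (ρ v k : ℕ) :
    stackSum q (hitWeight w ℓ p (i, ρ)) (seg m v k) ≤
      pathProb p m i * ({u ∈ descendants ℓ i m v k | u % 2 ^ w = ρ}.card : ℝ) := by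
  induction k generalizing v with
  | zero => simp [stackSum]
  | succ k ih =>
    rw [seg_succ, stackSum, ← descendants_succ, Finset.filter_union, Finset.card_union_of_disjoint
      (Finset.disjoint_filter_filter (disjoint_descendants i m v k)), Nat.cast_add, mul_add]
    refine add_le_add (by simp [hitWeight, hm]) (le_trans ?_ (ih (v + 1)))
    exact mul_le_of_le_one_left (stackSum_nonneg (fun j => (hq j).2) (hitWeight_nonneg hp _) _)
      (by linarith [(hq m).1])

lemma stackSum_hitWeight_of_lt {i m : ℕ} (hm : i < m) (ρ v k : ℕ) :
    stackSum q (hitWeight w ℓ p (i, ρ)) (seg m v k) = 0 :=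
  stackSum_eq_zero _ fun y hy => by simp [hitWeight, mem_seg hy, hm]

lemma hitWeight_step (hp : ∀ j, 0 < p j) (hq : ∀ j, 0 ≤ q j ∧ q j ≤ 1) (a y : ℕ × ℕ) :
    (if label w y = a then 1 else 0) +
      p y.1 * stackSum q (hitWeight w ℓ p a) (children ℓ y) ≤ hitWeight w ℓ p a y := by
  obtain ⟨i, ρ⟩ := a
  obtain ⟨m, v⟩ := y
  simp only [label, children]
  rcases lt_trichotomy m i with h | rfl | h
  · have h1 := stackSum_hitWeight_seg_le (w := w) (ℓ := ℓ) hp hq (Nat.succ_le_of_lt h) ρ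
      (v * 2 ^ ℓ (m + 1)) (2 ^ ℓ (m + 1))
    rw [Nat.succ_eq_add_one, descendants_children h] at h1
    simp only [hitWeight, h.le, if_true, Prod.mk.injEq, h.ne, false_and, if_false, zero_add]
    rw [pathProb_of_lt h, mul_assoc]
    exact mul_le_mul_of_nonneg_left h1 (hp m).le
  · rw [stackSum_hitWeight_of_lt (Nat.lt_succ_self m)]
    simp only [hitWeight, descendants_self, le_refl, if_true, pathProb_self, Finset.filter_singleton]
    split_ifs <;> simp_all
  · rw [stackSum_hitWeight_of_lt (by omega)]
    simp [hitWeight, h.ne', h.not_ge]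

end Hits

/-! ### The expected number of colliding pairs -/

/-- The expectation of the sum of `g` over the inspected nodes of layer `i` below `y`, restricted
to the event that the subtree of `y` fails. -/
def failSum (ℓ : ℕ → ℕ) (p q : ℕ → ℝ) (i : ℕ) (g : ℕ → ℝ) (y : ℕ × ℕ) : ℝ :=
  if y.1 ≤ i then pathFailProb ℓ p q y.1 i * ∑ u ∈ descendants ℓ i y.1 y.2 1, g u else 0

/-- The analogue of `failSum` for a stack of nodes. -/
def stackFailSum (ℓ : ℕ → ℕ) (p q : ℕ → ℝ) (i : ℕ) (g : ℕ → ℝ) : List (ℕ × ℕ) → ℝ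
  | [] => 0
  | y :: s => failSum ℓ p q i g y * failProb q s + (1 - q y.1) * stackFailSum ℓ p q i g s

/-- A bound on the expected number of pairs of nodes in layer `i`, inspected below a node of
layer `m`, that use the same variable. -/
noncomputable def nodePairs (w : ℕ) (q : ℕ → ℝ) (i m : ℕ) : ℝ :=
  if m ≤ i then q m * ((i : ℝ) - m) * (4 / (2 ^ w * q i ^ 2)) else 0

/-- A bound on the expected number of pairs of nodes in layer `i`, inspected below the nodes of the
stack, that use the same variable. -/
noncomputable def stackPairs (w : ℕ) (ℓ : ℕ → ℕ) (p q : ℕ → ℝ) (i : ℕ) : List (ℕ × ℕ) → ℝ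
  | [] => 0
  | y :: s => nodePairs w q i y.1 +
      failSum ℓ p q i (fun u => stackSum q (hitWeight w ℓ p (i, u % 2 ^ w)) s) y +
      (1 - q y.1) * stackPairs w ℓ p q i s

section Pairs

variable {n w : ℕ} {ℓ : ℕ → ℕ} {p q : ℕ → ℝ} {i : ℕ}

lemma failSum_add_mul (g g' : ℕ → ℝ) (e : ℝ) (y : ℕ × ℕ) :
    failSum ℓ p q i (fun u => g u + e * g' u) y = failSum ℓ p q i g y + e * failSum ℓ p q i g' y := by
  rw [failSum, failSum, failSum]
  split_ifs
  · rw [Finset.sum_add_distrib, ← Finset.mul_sum]; ring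
  · ring

/-- The three terms account for pairs within `l`, pairs between `l` and `s`, and pairs within `s`.
The last two kinds require every node of `l` to fail. -/
lemma stackPairs_append (l s : List (ℕ × ℕ)) :
    stackPairs w ℓ p q i (l ++ s) = stackPairs w ℓ p q i l +
      stackFailSum ℓ p q i (fun u => stackSum q (hitWeight w ℓ p (i, u % 2 ^ w)) s) l +
      failProb q l * stackPairs w ℓ p q i s := by
  induction l with
  | nil => simp [stackPairs, stackFailSum]
  | cons y l ih =>
    simp only [List.cons_append, stackPairs, ih, stackFailSum, failProb_cons, stackSum_append,
      failSum_add_mul]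
    ring

/-- A node of layer `i` lies below exactly one node of the segment, and the other `k - 1` must fail
too. For `k = 0` the truncated exponent is harmless because the sum is empty. -/
lemma stackFailSum_seg {m : ℕ} (hm : m ≤ i) (g : ℕ → ℝ) (v k : ℕ) :
    stackFailSum ℓ p q i g (seg m v k) =
      (1 - q m) ^ (k - 1) * (pathFailProb ℓ p q m i * ∑ u ∈ descendants ℓ i m v k, g u) := by
  induction k generalizing v with
  | zero => simp [stackFailSum]
  | succ k ih =>
    rw [seg_succ, stackFailSum, ih, failProb_seg, failSum, if_pos hm, ← descendants_succ i m v k,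
      Finset.sum_union (disjoint_descendants i m v k), Nat.add_sub_cancel]
    rcases k with _ | k
    · simp
    · rw [Nat.add_sub_cancel]; ring

lemma stackFailSum_seg_of_lt {m : ℕ} (hm : i < m) (g : ℕ → ℝ) (v k : ℕ) :
    stackFailSum ℓ p q i g (seg m v k) = 0 := by
  induction k generalizing v with
  | zero => rfl
  | succ k ih => rw [seg_succ, stackFailSum, ih, failSum, if_neg hm.not_ge]; ring

lemma stackPairs_seg_of_lt {m : ℕ} (hm : i < m) (v k : ℕ) :
    stackPairs w ℓ p q i (seg m v k) = 0 := by
  induction k generalizing v with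
  | zero => rfl
  | succ k ih =>
    rw [seg_succ, stackPairs, ih, failSum, nodePairs, if_neg hm.not_ge, if_neg hm.not_ge]; ring

lemma stackFailSum_children {y : ℕ × ℕ} (hy : y.1 < i) (g : ℕ → ℝ) :
    p y.1 * stackFailSum ℓ p q i g (children ℓ y) = failSum ℓ p q i g y := by
  rw [children, stackFailSum_seg hy, descendants_children hy, failSum, if_pos hy.le,
    pathFailProb_of_lt hy]
  ring

/-- Only elements beyond `u` are counted, so the differences `x - u` are positive multiples of `r`.
This avoids the usual additional 1, which would ruin the estimate for intervals shorter than `2 ^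
w`. -/
lemma card_filter_mod_le (a b e u r T : ℕ) (ha : u < a) (hb : b ≤ u + T) (he : u % r = e) :
    ({x ∈ Finset.Ico a b | x % r = e}.card : ℝ) ≤ T / r := by
  have h : {x ∈ Finset.Ico a b | x % r = e}.card ≤ (Finset.Icc 1 (T / r)).card := by
    have hdiv : ∀ x ∈ Finset.Ico a b, x % r = e → r * ((x - u) / r) = x - u := fun x hx hx' => by
      rw [Finset.mem_Ico] at hx
      exact Nat.mul_div_cancel' ((Nat.modEq_iff_dvd' (by omega)).mp (he.trans hx'.symm))
    refine Finset.card_le_card_of_injOn (fun x => (x - u) / r) (fun x hx => ?_) fun x hx x' hx' h => ?_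
    · simp only [Finset.coe_filter, Set.mem_ofPred_eq] at hx
      have h1 := hdiv x hx.1 hx.2
      have h2 := Finset.mem_Ico.mp hx.1
      simp only [Finset.coe_Icc, Set.mem_Icc]
      refine ⟨Nat.pos_of_ne_zero fun h0 => ?_, Nat.div_le_div_right (by omega)⟩
      rw [h0, mul_zero] at h1
      omega
    · simp only [Finset.coe_filter, Set.mem_ofPred_eq] at hx hx'
      have h1 := hdiv x hx.1 hx.2
      have h1' := hdiv x' hx'.1 hx'.2
      have h2 := Finset.mem_Ico.mp hx.1
      have h2' := Finset.mem_Ico.mp hx'.1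
      simp only at h
      rw [h] at h1
      omega
  rw [Nat.card_Icc, Nat.add_sub_cancel] at h
  exact (Nat.cast_le.mpr h).trans Nat.cast_div_le

lemma nodePairs_nonneg (hq : ∀ j, 0 ≤ q j) (m : ℕ) : 0 ≤ nodePairs w q i m := by
  rw [nodePairs]
  split_ifs with h
  · have : (m : ℝ) ≤ i := by exact_mod_cast h
    exact mul_nonneg (mul_nonneg (hq m) (by linarith)) (by positivity)
  · exact le_rfl

lemma failSum_nonneg (hp : ∀ j, 0 < p j) (hq : ∀ j, q j ≤ 1) {g : ℕ → ℝ} (hg : ∀ u, 0 ≤ g u)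
    (y : ℕ × ℕ) : 0 ≤ failSum ℓ p q i g y := by
  rw [failSum]
  split_ifs
  · exact mul_nonneg (pathFailProb_nonneg hp hq _ _) (Finset.sum_nonneg fun u _ => hg u)
  · exact le_rfl

lemma stackPairs_nonneg (hp : ∀ j, 0 < p j) (hq : ∀ j, 0 ≤ q j ∧ q j ≤ 1) (s : List (ℕ × ℕ)) :
    0 ≤ stackPairs w ℓ p q i s := by
  induction s with
  | nil => exact le_rfl
  | cons y s ih =>
    exact add_nonneg (add_nonneg (nodePairs_nonneg (fun j => (hq j).1) _) (failSum_nonneg hp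
      (fun j => (hq j).2) (fun u => stackSum_nonneg (fun j => (hq j).2) (hitWeight_nonneg hp _) _) _))
      (mul_nonneg (sub_nonneg.mpr (hq _).2) ih)

/-- Each node contributes its internal pairs and its pairs with later nodes of the segment. The
fixed bound `K` makes this contribution uniform, so the sum over the segment is a geometric series.
-/
lemma stackPairs_seg_le (hp : ∀ j, 0 < p j) (hq : ∀ j, 0 ≤ q j ∧ q j ≤ 1) {m : ℕ} (hm : m ≤ i)
    (v k K : ℕ) (hk : k ≤ K) :
    q m * stackPairs w ℓ p q i (seg m v k) ≤ (1 - (1 - q m) ^ k) * (nodePairs w q i m +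
      K / 2 ^ w * (4 ^ depth ℓ m i * (pathFailProb ℓ p q m i * pathProb p m i))) := by
  induction k generalizing v with
  | zero => simp [stackPairs]
  | succ k ih =>
    have hE := pathFailProb_nonneg (ℓ := ℓ) hp (fun j => (hq j).2) m i
    have hP := pathProb_nonneg hp m i
    set W := K / 2 ^ w * (4 ^ depth ℓ m i * (pathFailProb ℓ p q m i * pathProb p m i)) with hW
    have hf : failSum ℓ p q i
        (fun u => stackSum q (hitWeight w ℓ p (i, u % 2 ^ w)) (seg m (v + 1) k)) (m, v) ≤ W := by
      have h1 : ∀ u ∈ descendants ℓ i m v 1,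
          stackSum q (hitWeight w ℓ p (i, u % 2 ^ w)) (seg m (v + 1) k) ≤
            pathProb p m i * (K * 2 ^ depth ℓ m i / 2 ^ w) := fun u hu => by
        refine (stackSum_hitWeight_seg_le hp hq hm _ _ _).trans (mul_le_mul_of_nonneg_left ?_ hP)
        rw [descendants, Finset.mem_Ico] at hu
        refine (card_filter_mod_le _ _ _ u (2 ^ w) (K * 2 ^ depth ℓ m i) hu.2 ?_
          rfl).trans_eq (by push_cast; ring)
        calc (v + 1 + k) * 2 ^ depth ℓ m i = v * 2 ^ depth ℓ m i + (k + 1) * 2 ^ depth ℓ m i := by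
              ring
          _ ≤ _ := add_le_add hu.1 (Nat.mul_le_mul_right _ hk)
      rw [failSum, if_pos hm]
      have h2 := Finset.sum_le_card_nsmul _ _ _ h1
      rw [card_descendants, one_mul, nsmul_eq_mul] at h2
      refine (mul_le_mul_of_nonneg_left h2 hE).trans_eq ?_
      rw [hW, show (4 : ℝ) = 2 * 2 by norm_num, mul_pow]
      push_cast
      ring
    have h3 := ih (v + 1) (by omega)
    rw [seg_succ, stackPairs]
    have h4 := mul_le_mul_of_nonneg_left h3 (sub_nonneg.mpr (hq m).2)
    have h5 := mul_le_mul_of_nonneg_left hf (hq m).1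
    simp only at h5 ⊢
    rw [pow_succ']
    linarith

/-- Pairs that part at `y` raise the factor `i - (m + 1)` in `nodePairs` to `i - m`. This fits
because `2 ^ ℓ (m + 1) * q (m + 1) ≤ 4` and the AM-GM estimate bounds the rest by `q (m + 1) ^ 2 / q
i ^ 2`. -/
lemma stackPairs_children_le (hp : ∀ j, 0 < p j ∧ p j ≤ 1) (hi : i ≤ n)
    (hN : ∀ m, 1 ≤ m → m ≤ n → 2 ^ ℓ m * nodeProb n ℓ p m ≤ 4) (y : ℕ × ℕ) :
    p y.1 * stackPairs w ℓ p (nodeProb n ℓ p) i (children ℓ y)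
      ≤ nodePairs w (nodeProb n ℓ p) i y.1 := by
  obtain ⟨m, v⟩ := y
  have hq := nodeProb_mem (n := n) (ℓ := ℓ) hp
  have hq' := fun j => And.intro (hq j).1.le (hq j).2
  simp only [children]
  rcases Nat.lt_or_ge m i with hm | hm
  · have h1 := stackPairs_seg_le (w := w) (ℓ := ℓ) (fun j => (hp j).1) hq' (Nat.succ_le_of_lt hm)
      (v * 2 ^ ℓ (m + 1)) (2 ^ ℓ (m + 1)) (2 ^ ℓ (m + 1)) le_rfl
    have h2 := four_pow_mul_pathFailProb_mul_pathProb_le (ℓ := ℓ) hp (Nat.succ_le_of_lt hm) hi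
    have h3 := nodeProb_of_le (ℓ := ℓ) (p := p) (hm.le.trans hi)
    have h4 := hN (m + 1) (by omega) (by omega)
    rw [nodePairs, if_pos (Nat.succ_le_of_lt hm)] at h1
    rw [nodePairs, if_pos hm.le]
    have hqm := hq m
    have hqm1 := hq (m + 1)
    have hqi := hq i
    simp only [Nat.succ_eq_add_one] at *
    set q := nodeProb n ℓ p
    set X := 4 ^ depth ℓ (m + 1) i * (pathFailProb ℓ p q (m + 1) i * pathProb p (m + 1) i)
    have h5 : ((2 ^ ℓ (m + 1) : ℕ) : ℝ) / 2 ^ w * X ≤ q (m + 1) * (4 / (2 ^ w * q i ^ 2)) := by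
      have hX : X ≤ q (m + 1) ^ 2 / q i ^ 2 := by
        rw [le_div_iff₀ (pow_pos hqi.1 2)]; exact h2
      calc ((2 ^ ℓ (m + 1) : ℕ) : ℝ) / 2 ^ w * X
          ≤ ((2 ^ ℓ (m + 1) : ℕ) : ℝ) / 2 ^ w * (q (m + 1) ^ 2 / q i ^ 2) := by gcongr
        _ = (2 ^ ℓ (m + 1) * q (m + 1)) * (q (m + 1) / (2 ^ w * q i ^ 2)) := by push_cast; ring
        _ ≤ 4 * (q (m + 1) / (2 ^ w * q i ^ 2)) :=
          mul_le_mul_of_nonneg_right h4 (div_nonneg hqm1.1.le (by positivity))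
        _ = _ := by ring
    have h6 := mul_le_mul_of_nonneg_left h1 (hp m).1.le
    rw [← mul_assoc (p m) (1 - _), ← h3] at h6
    have h7 : q m * (q (m + 1) * (↑i - ↑(m + 1)) * (4 / (2 ^ w * q i ^ 2)) +
        ((2 ^ ℓ (m + 1) : ℕ) : ℝ) / 2 ^ w * X)
        ≤ q (m + 1) * (q m * (↑i - ↑m) * (4 / (2 ^ w * q i ^ 2))) := by
      refine (mul_le_mul_of_nonneg_left (add_le_add_right h5 _) hqm.1.le).trans_eq ?_
      push_cast
      ring
    refine le_of_mul_le_mul_left ?_ hqm1.1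
    calc _ = _ := by ring
      _ ≤ _ := h6.trans h7
  · rw [stackPairs_seg_of_lt (by omega), mul_zero]
    exact nodePairs_nonneg (fun j => (hq' j).1) _

/-- Once `y` is inspected, its pairs with future nodes become hits of an already inspected variable.
The extra term for `y.1 = i` is this transfer. -/
lemma stepMean_stackPairs_le (hp : ∀ j, 0 < p j ∧ p j ≤ 1) (hi : i ≤ n)
    (hN : ∀ m, 1 ≤ m → m ≤ n → 2 ^ ℓ m * nodeProb n ℓ p m ≤ 4) {y : ℕ × ℕ} (hy : y.1 ≤ n)
    (s : List (ℕ × ℕ)) :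
    stepMean ℓ p (stackPairs w ℓ p (nodeProb n ℓ p) i) y s + (if y.1 = i then
      stepMean ℓ p (stackSum (nodeProb n ℓ p) (hitWeight w ℓ p (label w y))) y s else 0)
      ≤ stackPairs w ℓ p (nodeProb n ℓ p) i (y :: s) := by
  have h1 := stackPairs_children_le (w := w) hp hi hN y
  have hf := failProb_children (ℓ := ℓ) (p := p) hy
  rw [stepMean, stackPairs_append, stackPairs, ← hf]
  rcases lt_trichotomy y.1 i with h | h | h
  · rw [if_neg h.ne, ← stackFailSum_children h]
    linarith
  · subst h
    rw [if_pos rfl, stepMean, stackSum_append]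
    have h2 : failSum ℓ p (nodeProb n ℓ p) y.1
        (fun u => stackSum (nodeProb n ℓ p) (hitWeight w ℓ p (y.1, u % 2 ^ w)) s) y
        = (1 - nodeProb n ℓ p y.1) *
          stackSum (nodeProb n ℓ p) (hitWeight w ℓ p (label w y)) s := by
      simp [failSum, pathFailProb_self, label]
    have h3 : stackSum (nodeProb n ℓ p) (hitWeight w ℓ p (label w y)) (children ℓ y) = 0 :=
      stackSum_hitWeight_of_lt (by omega) _ _ _
    rw [h2, h3, ← hf, children, stackFailSum_seg_of_lt (by omega)]
    rw [children] at h1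
    linarith
  · rw [if_neg h.ne', children, stackFailSum_seg_of_lt (by omega)]
    have h2 : 0 ≤ failSum ℓ p (nodeProb n ℓ p) i
        (fun u => stackSum (nodeProb n ℓ p) (hitWeight w ℓ p (i, u % 2 ^ w)) s) y := by
      simp [failSum, h.not_ge]
    rw [children] at h1
    linarith

end Pairs

/-! ### The potential -/

/-- A bound on the probability that the search fails or inspects a variable twice, if the variables
in `H` have been inspected already. -/
noncomputable def potential (n w : ℕ) (ℓ : ℕ → ℕ) (p : ℕ → ℝ) (H : Finset (ℕ × ℕ))
    (s : List (ℕ × ℕ)) : ℝ :=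
  failProb (nodeProb n ℓ p) s +
    ∑ i ∈ Finset.Icc 1 n, stackPairs w ℓ p (nodeProb n ℓ p) i s +
    ∑ a ∈ H, stackSum (nodeProb n ℓ p) (hitWeight w ℓ p a) s

/-- The expected number of inspections in layer `i`. -/
noncomputable def expectedCount (n : ℕ) (ℓ : ℕ → ℕ) (p : ℕ → ℝ) (i : ℕ) (s : List (ℕ × ℕ)) : ℝ :=
  stackSum (nodeProb n ℓ p)
    (fun y => if y.1 ≤ i then nodeProb n ℓ p y.1 / nodeProb n ℓ p i else 0) s

section Potential

variable {n w : ℕ} {ℓ : ℕ → ℕ} {p : ℕ → ℝ}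

lemma potential_nonneg (hp : ∀ j, 0 < p j ∧ p j ≤ 1) (H : Finset (ℕ × ℕ)) (s : List (ℕ × ℕ)) :
    0 ≤ potential n w ℓ p H s := by
  have hq := nodeProb_mem (n := n) (ℓ := ℓ) hp
  have hq' := fun j => And.intro (hq j).1.le (hq j).2
  refine add_nonneg (add_nonneg (failProb_nonneg (fun j => (hq j).2) _) (Finset.sum_nonneg fun i _ =>
    stackPairs_nonneg (fun j => (hp j).1) hq' _)) (Finset.sum_nonneg fun a _ =>
    stackSum_nonneg (fun j => (hq j).2) (hitWeight_nonneg (fun j => (hp j).1) _) _)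

lemma one_le_potential_nil (H : Finset (ℕ × ℕ)) : 1 ≤ potential n w ℓ p H [] := by
  simp [potential, stackPairs, stackSum]

lemma one_le_potential_cons (hp : ∀ j, 0 < p j ∧ p j ≤ 1) {H : Finset (ℕ × ℕ)} {y : ℕ × ℕ}
    (hy : label w y ∈ H) (s : List (ℕ × ℕ)) : 1 ≤ potential n w ℓ p H (y :: s) := by
  have hq := nodeProb_mem (n := n) (ℓ := ℓ) hp
  have hq' := fun j => And.intro (hq j).1.le (hq j).2
  have hp' := fun j => (hp j).1
  have hX := fun a s => stackSum_nonneg (s := s) (fun j => (hq j).2)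
    (hitWeight_nonneg (w := w) (ℓ := ℓ) hp' a)
  have h1 : 1 ≤ stackSum (nodeProb n ℓ p) (hitWeight w ℓ p (label w y)) (y :: s) := by
    have h2 := hitWeight_step (w := w) (ℓ := ℓ) hp' hq' (label w y) y
    rw [if_pos rfl] at h2
    rw [stackSum]
    have h3 := mul_nonneg (hp' y.1).le (hX (label w y) (children ℓ y))
    have h4 := mul_nonneg (sub_nonneg.mpr (hq y.1).2) (hX (label w y) s)
    linarith
  have h2 := Finset.single_le_sum (f := fun a => stackSum (nodeProb n ℓ p) (hitWeight w ℓ p a)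
    (y :: s)) (fun a _ => hX a _) hy
  have h3 := failProb_nonneg (fun j => (hq j).2) (y :: s)
  have h4 : 0 ≤ ∑ i ∈ Finset.Icc 1 n, stackPairs w ℓ p (nodeProb n ℓ p) i (y :: s) :=
    Finset.sum_nonneg fun i _ => stackPairs_nonneg hp' hq' _
  rw [potential]
  linarith

/-- The failure term is a martingale and each hit term is a supermartingale. The new summand for
`label w y` is paid for by the decrease of the pair term in the layer of `y`. -/
lemma stepMean_potential_le (hp : ∀ j, 0 < p j ∧ p j ≤ 1)
    (hN : ∀ m, 1 ≤ m → m ≤ n → 2 ^ ℓ m * nodeProb n ℓ p m ≤ 4) {H : Finset (ℕ × ℕ)} {y : ℕ × ℕ}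
    (hy : y.1 ∈ Finset.Icc 1 n) (hH : label w y ∉ H) (s : List (ℕ × ℕ)) :
    stepMean ℓ p (potential n w ℓ p (insert (label w y) H)) y s ≤ potential n w ℓ p H (y :: s) := by
  have hq := nodeProb_mem (n := n) (ℓ := ℓ) hp
  have hq' := fun j => And.intro (hq j).1.le (hq j).2
  have hyn := (Finset.mem_Icc.mp hy).2
  have h1 := stepMean_failProb (ℓ := ℓ) (p := p) hyn s
  have h2 := Finset.sum_le_sum fun i (hi : i ∈ Finset.Icc 1 n) =>
    stepMean_stackPairs_le (w := w) hp (Finset.mem_Icc.mp hi).2 hN hyn s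
  rw [Finset.sum_add_distrib, Finset.sum_ite_eq, if_pos hy] at h2
  have h3 : ∑ a ∈ H, stepMean ℓ p (stackSum (nodeProb n ℓ p) (hitWeight w ℓ p a)) y s ≤
      ∑ a ∈ H, stackSum (nodeProb n ℓ p) (hitWeight w ℓ p a) (y :: s) :=
    Finset.sum_le_sum fun a _ => by
      have h4 := stepMean_stackSum_le hyn s
        (hitWeight_step (w := w) (ℓ := ℓ) (fun j => (hp j).1) hq' a y)
      refine le_trans ?_ h4
      split_ifs <;> linarith
  simp only [stepMean, Finset.sum_add_distrib, ← Finset.mul_sum] at h1 h2 h3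
  simp only [stepMean, potential, Finset.sum_insert hH]
  linarith

lemma expectedCount_nonneg (hp : ∀ j, 0 < p j ∧ p j ≤ 1) (i : ℕ) (s : List (ℕ × ℕ)) :
    0 ≤ expectedCount n ℓ p i s := by
  have hq := nodeProb_mem (n := n) (ℓ := ℓ) hp
  refine stackSum_nonneg (fun j => (hq j).2) (fun y => ?_) s
  split_ifs
  · exact div_nonneg (hq _).1.le (hq _).1.le
  · exact le_rfl

/-- The weight `q m / q i` is the expected number of inspections in layer `i` below a node of layer
`m ≤ i`: times `q i`, it is the probability that one of them leads to success. -/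
lemma stepMean_expectedCount_le (hp : ∀ j, 0 < p j ∧ p j ≤ 1) (i : ℕ) {y : ℕ × ℕ} (hy : y.1 ≤ n)
    (s : List (ℕ × ℕ)) :
    (if y.1 = i then 1 else 0) + stepMean ℓ p (expectedCount n ℓ p i) y s
      ≤ expectedCount n ℓ p i (y :: s) := by
  have hq := nodeProb_mem (n := n) (ℓ := ℓ) hp
  refine stepMean_stackSum_le hy s ?_
  have h1 := stackSum_seg (q := nodeProb n ℓ p)
    (g := fun m => if m ≤ i then nodeProb n ℓ p m / nodeProb n ℓ p i else 0)
    (y.1 + 1) (y.2 * 2 ^ ℓ (y.1 + 1)) (2 ^ ℓ (y.1 + 1))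
  rw [children]
  set X := stackSum _ _ _
  have hq1 := (hq (y.1 + 1)).1
  have hqi := (hq i).1
  rcases lt_trichotomy y.1 i with h | h | h
  · rw [if_pos (Nat.succ_le_of_lt h)] at h1
    have h2 : X = (1 - (1 - nodeProb n ℓ p (y.1 + 1)) ^ 2 ^ ℓ (y.1 + 1)) / nodeProb n ℓ p i := by
      rw [eq_div_iff hqi.ne']
      refine mul_left_cancel₀ hq1.ne' ?_
      rw [← mul_assoc, h1]
      field_simp
    rw [if_neg h.ne, if_pos h.le, h2, nodeProb_of_le hy, zero_add, mul_div_assoc]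
  · rw [if_neg (by omega), zero_mul] at h1
    have h2 : X = 0 := (mul_eq_zero.mp h1).resolve_left hq1.ne'
    rw [if_pos h, if_pos h.le, h2, h, div_self hqi.ne']
    simp
  · rw [if_neg (by omega), zero_mul] at h1
    have h2 : X = 0 := (mul_eq_zero.mp h1).resolve_left hq1.ne'
    rw [if_neg h.ne', if_neg h.not_ge, h2]
    simp

lemma expectedCount_seg_le (hp : ∀ j, 0 < p j ∧ p j ≤ 1) {i : ℕ} (hi : 1 ≤ i) (k : ℕ) :
    expectedCount n ℓ p i (seg 1 0 k) ≤ 1 / nodeProb n ℓ p i := by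
  have hq := nodeProb_mem (n := n) (ℓ := ℓ) hp
  have h1 := stackSum_seg (q := nodeProb n ℓ p)
    (g := fun m => if m ≤ i then nodeProb n ℓ p m / nodeProb n ℓ p i else 0) 1 0 k
  rw [if_pos hi] at h1
  refine le_of_mul_le_mul_left ?_ (hq 1).1
  rw [expectedCount, h1, mul_one_div]
  refine mul_le_of_le_one_right (div_nonneg (hq 1).1.le (hq i).1.le) ?_
  have := pow_nonneg (sub_nonneg.mpr (hq 1).2) k
  linarith

/-- In `n + 2 ^ κ`, the first summand accounts for pairs below a common node of layer 1 and the
second for pairs below different ones. -/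
lemma potential_seg_le (hp : ∀ j, 0 < p j ∧ p j ≤ 1) (hn : 1 ≤ n)
    (hN : ∀ m, 1 ≤ m → m ≤ n → 2 ^ ℓ m * nodeProb n ℓ p m ≤ 4) (κ : ℕ) :
    potential n w ℓ p ∅ (seg 1 0 (2 ^ κ * 2 ^ ℓ 1)) ≤
      (1 - nodeProb n ℓ p 1) ^ (2 ^ κ * 2 ^ ℓ 1) +
      ∑ i ∈ Finset.Icc 1 n, 4 * (n + 2 ^ κ) / (2 ^ w * nodeProb n ℓ p i ^ 2) := by
  have hq := nodeProb_mem (n := n) (ℓ := ℓ) hp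
  have hq' := fun j => And.intro (hq j).1.le (hq j).2
  have hp' := fun j => (hp j).1
  rw [potential, failProb_seg, Finset.sum_empty, add_zero]
  refine add_le_add_right (Finset.sum_le_sum fun i hi => ?_) _
  obtain ⟨hi1, hin⟩ := Finset.mem_Icc.mp hi
  have h1 := stackPairs_seg_le (w := w) (ℓ := ℓ) hp' hq' hi1 0 (2 ^ κ * 2 ^ ℓ 1) _ le_rfl
  have h2 := four_pow_mul_pathFailProb_mul_pathProb_le (ℓ := ℓ) hp hi1 hin
  have h4 := hN 1 le_rfl hn
  rw [nodePairs, if_pos hi1] at h1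
  have hE := pathFailProb_nonneg (ℓ := ℓ) hp' (fun j => (hq j).2) 1 i
  have hP := pathProb_nonneg hp' 1 i
  have hq1 := hq 1
  have hqi := hq i
  set q := nodeProb n ℓ p
  set X := 4 ^ depth ℓ 1 i * (pathFailProb ℓ p q 1 i * pathProb p 1 i) with hXdef
  have hX0 : 0 ≤ X := by positivity
  have hX : X ≤ q 1 ^ 2 / q i ^ 2 := by
    rw [le_div_iff₀ (pow_pos hqi.1 2)]; exact h2
  have hle : (1 : ℝ) ≤ i := by exact_mod_cast hi1
  have hle' : (i : ℝ) ≤ n := by exact_mod_cast hin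
  refine le_of_mul_le_mul_left (h1.trans ?_) hq1.1
  have h5 : 0 ≤ (1 - q 1) ^ (2 ^ κ * 2 ^ ℓ 1) := pow_nonneg (sub_nonneg.mpr hq1.2) _
  have hQ : 0 < 2 ^ w * q i ^ 2 := mul_pos (by positivity) (pow_pos hqi.1 2)
  have h6 : ((2 ^ κ * 2 ^ ℓ 1 : ℕ) : ℝ) / 2 ^ w * X ≤ q 1 * (4 * 2 ^ κ / (2 ^ w * q i ^ 2)) := by
    calc ((2 ^ κ * 2 ^ ℓ 1 : ℕ) : ℝ) / 2 ^ w * X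
        ≤ ((2 ^ κ * 2 ^ ℓ 1 : ℕ) : ℝ) / 2 ^ w * (q 1 ^ 2 / q i ^ 2) := by gcongr
      _ = (2 ^ ℓ 1 * q 1) * (q 1 * 2 ^ κ / (2 ^ w * q i ^ 2)) := by push_cast; ring
      _ ≤ 4 * (q 1 * 2 ^ κ / (2 ^ w * q i ^ 2)) :=
        mul_le_mul_of_nonneg_right h4 (div_nonneg (mul_nonneg hq1.1.le (by positivity)) hQ.le)
      _ = _ := by ring
  have h7 : q 1 * (i - (1 : ℕ)) * (4 / (2 ^ w * q i ^ 2)) ≤ q 1 * (4 * n / (2 ^ w * q i ^ 2)) := by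
    rw [mul_assoc]
    refine mul_le_mul_of_nonneg_left ?_ hq1.1.le
    rw [mul_div_assoc', Nat.cast_one]
    exact div_le_div_of_nonneg_right (by linarith) hQ.le
  refine (mul_le_of_le_one_left ?_ (by linarith)).trans ?_
  · refine add_nonneg (mul_nonneg (mul_nonneg hq1.1.le ?_) (by positivity)) (by positivity)
    simpa using hle
  · refine (add_le_add h7 h6).trans_eq ?_
    ring

end Potential

/-! ### The search with independent Bernoulli variables -/

/-- The event that the variables in `H` have the values given by `β`. -/
def cylinder {Ω : Type*} (B : ℕ → ℕ → Ω → Bool) (H : Finset (ℕ × ℕ)) (β : ℕ × ℕ → Bool) : Set Ω :=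
  {ω | ∀ a ∈ H, B a.1 a.2 ω = β a}

/-- The probability that a variable of layer `m` has the value `x`. -/
def valueProb (p : ℕ → ℝ) (m : ℕ) (x : Bool) : ℝ := if x = true then p m else 1 - p m

/-- All elements of the list or set belong to the layers `1, …, n`. -/
def InLayers {α : Type*} [Membership (ℕ × ℕ) α] (n : ℕ) (s : α) : Prop :=
  ∀ y ∈ s, y.1 ∈ Finset.Icc 1 n

lemma InLayers.children {n : ℕ} (ℓ : ℕ → ℕ) {y : ℕ × ℕ} {s : List (ℕ × ℕ)} (h : InLayers n (y :: s))
    (hy : y.1 ≠ n) : InLayers n (children ℓ y ++ s) := by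
  intro z hz
  rcases List.mem_append.mp hz with hz | hz
  · have h1 := Finset.mem_Icc.mp (h y (by simp))
    rw [mem_seg hz, Finset.mem_Icc]
    omega
  · exact h z (by simp [hz])

lemma InLayers.tail {n : ℕ} {y : ℕ × ℕ} {s : List (ℕ × ℕ)} (h : InLayers n (y :: s)) :
    InLayers n s := fun z hz => h z (by simp [hz])

lemma InLayers.insert_label {n : ℕ} (w : ℕ) {y : ℕ × ℕ} {s : List (ℕ × ℕ)} {H : Finset (ℕ × ℕ)}
    (h : InLayers n (y :: s)) (hH : InLayers n H) : InLayers n (insert (label w y) H) := by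
  intro z hz
  rcases Finset.mem_insert.mp hz with rfl | hz
  · exact h y (by simp)
  · exact hH z hz

/-- The number of nodes of layers `m, …, n` in the subtree of a node of layer `m`. -/
def nodeSize (n : ℕ) (ℓ : ℕ → ℕ) (m : ℕ) : ℕ :=
  if n ≤ m then 1 else 1 + 2 ^ ℓ (m + 1) * nodeSize n ℓ (m + 1)
termination_by n - m

/-- The number of nodes below the nodes of a stack. -/
def stackSize (n : ℕ) (ℓ : ℕ → ℕ) (s : List (ℕ × ℕ)) : ℕ := (s.map fun y => nodeSize n ℓ y.1).sum

lemma one_le_nodeSize (n : ℕ) (ℓ : ℕ → ℕ) (m : ℕ) : 1 ≤ nodeSize n ℓ m := by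
  rw [nodeSize]; split_ifs <;> omega

lemma stackSize_cons (n : ℕ) (ℓ : ℕ → ℕ) (y : ℕ × ℕ) (s : List (ℕ × ℕ)) :
    stackSize n ℓ (y :: s) = nodeSize n ℓ y.1 + stackSize n ℓ s := by simp [stackSize]

lemma stackSize_children {n : ℕ} (ℓ : ℕ → ℕ) {y : ℕ × ℕ} (hy : y.1 < n) (s : List (ℕ × ℕ)) :
    stackSize n ℓ (children ℓ y ++ s) + 1 = stackSize n ℓ (y :: s) := by
  have h : ∀ m v k, stackSize n ℓ (seg m v k) = k * nodeSize n ℓ m := fun m v k => by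
    induction k generalizing v with
    | zero => simp [stackSize]
    | succ k ih => rw [seg_succ, stackSize_cons, ih]; ring
  have h1 : stackSize n ℓ (children ℓ y ++ s) = stackSize n ℓ (children ℓ y) + stackSize n ℓ s := by
    simp [stackSize]
  rw [h1, children, h, stackSize_cons, nodeSize.eq_1 n ℓ y.1, if_neg (by omega)]
  ring

/-! ### Unfolding the search and its direct descent -/

section Deterministic

variable {n w : ℕ} {ℓ : ℕ → ℕ} {b : ℕ → ℕ → Bool}

lemma freshSuccess_cons (t : ℕ) (H : Finset (ℕ × ℕ)) (y : ℕ × ℕ) (s : List (ℕ × ℕ)) :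
    FreshSuccess n w ℓ b (t + 1) H (y :: s) ↔ label w y ∉ H ∧
      ((b y.1 (y.2 % 2 ^ w) = true ∧
        (y.1 = n ∨ FreshSuccess n w ℓ b t (insert (label w y) H) (children ℓ y ++ s))) ∨
      (b y.1 (y.2 % 2 ^ w) = false ∧ FreshSuccess n w ℓ b t (insert (label w y) H) s)) := by
  rw [FreshSuccess]
  cases b y.1 (y.2 % 2 ^ w) <;> simp

/-- The first child of index 0 again has index 0, so the search descends directly; freshness holds
because every inspection lies in a new layer. -/
lemma freshSuccess_of_zero (hb : ∀ i ∈ Finset.Icc 1 n, b i 0 = true) (t m : ℕ) (hm : 1 ≤ m)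
    (hmn : m ≤ n) (ht : n + 1 ≤ t + m) (H : Finset (ℕ × ℕ)) (hH : ∀ a ∈ H, a.1 < m)
    (s : List (ℕ × ℕ)) : FreshSuccess n w ℓ b t H ((m, 0) :: s) := by
  induction t generalizing m H s with
  | zero => omega
  | succ t ih =>
    refine (freshSuccess_cons ..).mpr ⟨fun h => (hH _ h).false,
      Or.inl ⟨by simpa using hb m (Finset.mem_Icc.mpr ⟨hm, hmn⟩), ?_⟩⟩
    rcases hmn.lt_or_eq with h | h
    · right
      rw [children, zero_mul, ← Nat.sub_add_cancel (Nat.one_le_two_pow (n := ℓ (m + 1))), seg_succ,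
        List.cons_append]
      refine ih (m + 1) (by omega) h (by omega) _ (fun a ha => ?_) _
      rcases Finset.mem_insert.mp ha with rfl | ha
      · exact Nat.lt_succ_self m
      · exact (hH a ha).trans (Nat.lt_succ_self m)
    · exact Or.inl h

end Deterministic

/-! ### Conditioning on the inspected variables -/

section Probability

variable {Ω : Type*} [MeasurableSpace Ω] {μ : Measure Ω} [IsProbabilityMeasure μ] {n w : ℕ}
  {ℓ : ℕ → ℕ} {p : ℕ → ℝ} {B : ℕ → ℕ → Ω → Bool}

lemma IsBernoulliFamily.measureReal_eq (hB : IsBernoulliFamily μ n p B)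
    (hp : ∀ j, 0 < p j ∧ p j ≤ 1) {i : ℕ} (hi : i ∈ Finset.Icc 1 n) (j : ℕ) (x : Bool) :
    μ.real {ω | B i j ω = x} = valueProb p i x := by
  have h1 : μ.real {ω | B i j ω = true} = p i := by
    rw [Measure.real, hB.prob i hi j, ENNReal.toReal_ofReal (hp i).1.le]
  cases x with
  | true => simpa [valueProb] using h1
  | false =>
    have h2 : {ω | B i j ω = false} = {ω | B i j ω = true}ᶜ := by ext; simp
    have h3 : MeasurableSet {ω | B i j ω = true} :=
      hB.measurable i hi j (MeasurableSet.singleton true)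
    rw [h2, probReal_compl_eq_one_sub h3, h1]
    simp [valueProb]

lemma IsBernoulliFamily.measureReal_cylinder (hB : IsBernoulliFamily μ n p B)
    (hp : ∀ j, 0 < p j ∧ p j ≤ 1) {H : Finset (ℕ × ℕ)} (hH : InLayers n H) (β : ℕ × ℕ → Bool) :
    μ.real (cylinder B H β) = ∏ a ∈ H, valueProb p a.1 (β a) := by
  let e : (Set.Icc 1 n : Set ℕ) × ℕ → ℕ × ℕ := fun a => (a.1, a.2)
  have he : Function.Injective e := fun a a' h => by
    simp only [e, Prod.mk.injEq] at h
    exact Prod.ext (Subtype.ext h.1) h.2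
  have hr : ∀ a ∈ H, a ∈ Set.range e := fun a ha =>
    ⟨(⟨a.1, by simpa using hH a ha⟩, a.2), rfl⟩
  have h1 := hB.indep.measure_inter_preimage_eq_mul (H.preimage e he.injOn)
    (sets := fun a => {β (e a)}) fun a _ => MeasurableSet.singleton _
  have h2 : cylinder B H β = ⋂ a ∈ H.preimage e he.injOn, (B a.1 a.2) ⁻¹' {β (e a)} := by
    ext ω
    simp only [cylinder, Set.mem_ofPred_eq, Set.mem_iInter, Finset.mem_preimage, Set.mem_preimage,
      Set.mem_singleton_iff]
    refine ⟨fun h a ha => h _ ha, fun h a ha => ?_⟩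
    obtain ⟨a', rfl⟩ := hr a ha
    exact h a' ha
  rw [← Finset.prod_preimage e H he.injOn _ fun a ha ha' => absurd (hr a ha) ha', h2, Measure.real,
    h1, ENNReal.toReal_prod]
  refine Finset.prod_congr rfl fun a _ => ?_
  exact hB.measureReal_eq hp (Finset.mem_Icc.mpr a.1.2) a.2 (β (e a))

omit [IsProbabilityMeasure μ] in
lemma measurableSet_cylinder (hB : IsBernoulliFamily μ n p B) {H : Finset (ℕ × ℕ)}
    (hH : InLayers n H) (β : ℕ × ℕ → Bool) : MeasurableSet (cylinder B H β) := by
  have : cylinder B H β = ⋂ a ∈ H, (B a.1 a.2) ⁻¹' {β a} := by ext; simp [cylinder]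
  rw [this]
  exact Finset.measurableSet_biInter _ fun a ha =>
    hB.measurable a.1 (hH a ha) a.2 (MeasurableSet.singleton _)

omit [MeasurableSpace Ω] in
lemma cylinder_insert {H : Finset (ℕ × ℕ)} {a : ℕ × ℕ} (ha : a ∉ H) (β : ℕ × ℕ → Bool) (x : Bool) :
    cylinder B (insert a H) (Function.update β a x) = cylinder B H β ∩ {ω | B a.1 a.2 ω = x} := by
  ext ω
  simp only [cylinder, Finset.forall_mem_insert, Set.mem_ofPred_eq, Function.update_self,
    Set.mem_inter_iff]
  rw [and_comm]
  refine and_congr_left fun _ => forall₂_congr fun a' ha' => ?_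
  rw [Function.update_of_ne (ne_of_mem_of_not_mem ha' ha)]

omit [MeasurableSpace Ω] in
lemma cylinder_eq_union {H : Finset (ℕ × ℕ)} {a : ℕ × ℕ} (ha : a ∉ H) (β : ℕ × ℕ → Bool) :
    cylinder B H β = cylinder B (insert a H) (Function.update β a true) ∪
      cylinder B (insert a H) (Function.update β a false) := by
  rw [cylinder_insert ha, cylinder_insert ha, ← Set.inter_union_distrib_left]
  refine (Set.inter_eq_left.mpr fun ω _ => ?_).symm
  cases h : B a.1 a.2 ω
  · exact Or.inr h
  · exact Or.inl h

lemma IsBernoulliFamily.measureReal_cylinder_insert (hB : IsBernoulliFamily μ n p B)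
    (hp : ∀ j, 0 < p j ∧ p j ≤ 1) {H : Finset (ℕ × ℕ)} {a : ℕ × ℕ} (ha : a ∉ H)
    (hH : InLayers n (insert a H)) (β : ℕ × ℕ → Bool) (x : Bool) :
    μ.real (cylinder B (insert a H) (Function.update β a x)) =
      valueProb p a.1 x * μ.real (cylinder B H β) := by
  rw [hB.measureReal_cylinder hp hH, Finset.prod_insert ha, Function.update_self,
    hB.measureReal_cylinder hp fun y hy => hH y (Finset.mem_insert_of_mem hy)]
  congr 1
  refine Finset.prod_congr rfl fun a' ha' => ?_
  rw [Function.update_of_ne (ne_of_mem_of_not_mem ha' ha)]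

omit [IsProbabilityMeasure μ] in
lemma measurableSet_freshSuccess (hB : IsBernoulliFamily μ n p B) (t : ℕ) (H : Finset (ℕ × ℕ))
    (s : List (ℕ × ℕ)) (hs : InLayers n s) :
    MeasurableSet {ω | FreshSuccess n w ℓ (fun i j => B i j ω) t H s} := by
  induction t generalizing H s with
  | zero => simp [FreshSuccess]
  | succ t ih =>
    rcases s with _ | ⟨y, s⟩
    · simp [FreshSuccess]
    · have hy := hB.measurable y.1 (hs y (by simp)) (y.2 % 2 ^ w) (MeasurableSet.singleton true)
      have h2 := ih (insert (label w y) H) s hs.tail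
      have hy' := hB.measurable y.1 (hs y (by simp)) (y.2 % 2 ^ w) (MeasurableSet.singleton false)
      have h1 : MeasurableSet {ω | y.1 = n ∨ FreshSuccess n w ℓ (fun i j => B i j ω) t
          (insert (label w y) H) (children ℓ y ++ s)} := by
        by_cases hyn : y.1 = n
        · simp [hyn]
        · simpa [hyn] using ih (insert (label w y) H) _ (hs.children ℓ hyn)
      simp only [freshSuccess_cons]
      exact (MeasurableSet.const _).inter ((hy.inter h1).union (hy'.inter h2))

lemma measureReal_not_freshSuccess_le_of_one_le (β : ℕ × ℕ → Bool) {H : Finset (ℕ × ℕ)}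
    {s : List (ℕ × ℕ)} (h : 1 ≤ potential n w ℓ p H s) (t : ℕ) :
    μ.real (cylinder B H β ∩ {ω | ¬ FreshSuccess n w ℓ (fun i j => B i j ω) t H s})
      ≤ μ.real (cylinder B H β) * potential n w ℓ p H s :=
  (measureReal_mono Set.inter_subset_left).trans (le_mul_of_one_le_right measureReal_nonneg h)

/-- Given the variables in `H`, the search fails or repeats an inspection with probability at most
the value of the potential. -/
lemma measureReal_not_freshSuccess_le (hB : IsBernoulliFamily μ n p B)
    (hp : ∀ j, 0 < p j ∧ p j ≤ 1)
    (hN : ∀ m, 1 ≤ m → m ≤ n → 2 ^ ℓ m * nodeProb n ℓ p m ≤ 4) (t : ℕ) (H : Finset (ℕ × ℕ))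
    (β : ℕ × ℕ → Bool) (s : List (ℕ × ℕ)) (ht : stackSize n ℓ s ≤ t) (hH : InLayers n H)
    (hs : InLayers n s) :
    μ.real (cylinder B H β ∩ {ω | ¬ FreshSuccess n w ℓ (fun i j => B i j ω) t H s})
      ≤ μ.real (cylinder B H β) * potential n w ℓ p H s := by
  induction t generalizing H β s with
  | zero =>
    rcases s with _ | ⟨y, s⟩
    · exact measureReal_not_freshSuccess_le_of_one_le β (one_le_potential_nil H) _
    · have := one_le_nodeSize n ℓ y.1
      rw [stackSize_cons] at ht
      omega
  | succ t ih =>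
    rcases s with _ | ⟨y, s⟩
    · exact measureReal_not_freshSuccess_le_of_one_le β (one_le_potential_nil H) _
    by_cases hyH : label w y ∈ H
    · exact measureReal_not_freshSuccess_le_of_one_le β (one_le_potential_cons hp hyH s) _
    have hy := hs y (by simp)
    have hH' := hs.insert_label w hH
    have hpot := fun s => potential_nonneg (n := n) (w := w) (ℓ := ℓ) hp (insert (label w y) H) s
    have hM : 0 ≤ μ.real (cylinder B H β) := measureReal_nonneg
    have h1 : μ.real (cylinder B (insert (label w y) H) (Function.update β (label w y) true) ∩
        {ω | ¬ FreshSuccess n w ℓ (fun i j => B i j ω) (t + 1) H (y :: s)}) ≤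
        p y.1 * μ.real (cylinder B H β) *
          potential n w ℓ p (insert (label w y) H) (children ℓ y ++ s) := by
      rcases eq_or_ne y.1 n with hyn | hyn
      -- A fresh success in layer `n` ends the search, so this branch contributes no failure.
      · refine le_of_eq_of_le ?_ (mul_nonneg (mul_nonneg (hp _).1.le hM) (hpot _))
        rw [measureReal_eq_zero_iff, cylinder_insert hyH]
        convert measure_empty (μ := μ)
        ext ω
        simp only [Set.mem_empty_iff_false, iff_false]
        rintro ⟨h, h'⟩
        exact h' ((freshSuccess_cons ..).mpr ⟨hyH, Or.inl ⟨h.2, Or.inl hyn⟩⟩)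
      · have h2 := stackSize_children ℓ (lt_of_le_of_ne (Finset.mem_Icc.mp hy).2 hyn) s
        have h3 := ih (insert (label w y) H) (Function.update β (label w y) true)
          (children ℓ y ++ s) (by omega) hH' (hs.children ℓ hyn)
        rw [hB.measureReal_cylinder_insert hp hyH hH'] at h3
        refine le_trans (measureReal_mono ?_) h3
        rintro ω ⟨h4, h5⟩
        refine ⟨h4, fun h => h5 ?_⟩
        rw [cylinder_insert hyH] at h4
        exact (freshSuccess_cons ..).mpr ⟨hyH, Or.inl ⟨h4.2, Or.inr h⟩⟩
    have h2 : μ.real (cylinder B (insert (label w y) H) (Function.update β (label w y) false) ∩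
        {ω | ¬ FreshSuccess n w ℓ (fun i j => B i j ω) (t + 1) H (y :: s)}) ≤
        (1 - p y.1) * μ.real (cylinder B H β) *
          potential n w ℓ p (insert (label w y) H) s := by
      have h2 := one_le_nodeSize n ℓ y.1
      rw [stackSize_cons] at ht
      have h3 := ih (insert (label w y) H) (Function.update β (label w y) false)
        s (by omega) hH' hs.tail
      rw [hB.measureReal_cylinder_insert hp hyH hH'] at h3
      refine le_trans (measureReal_mono ?_) h3
      rintro ω ⟨h4, h5⟩
      refine ⟨h4, fun h => h5 ?_⟩
      rw [cylinder_insert hyH] at h4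
      exact (freshSuccess_cons ..).mpr ⟨hyH, Or.inr ⟨h4.2, h⟩⟩
    rw [cylinder_eq_union hyH, Set.union_inter_distrib_right]
    refine (measureReal_union_le _ _).trans ((add_le_add h1 h2).trans ?_)
    rw [← cylinder_eq_union hyH]
    have h3 := mul_le_mul_of_nonneg_left (stepMean_potential_le hp hN hy hyH s) hM
    refine le_trans (le_of_eq ?_) h3
    rw [stepMean]
    ring

/-- Same conditioning as for the potential, with `expectedCount` as supermartingale. No lower bound
on `t` is required, since stopping early only decreases the count. -/
lemma lintegral_freshCount_le (hB : IsBernoulliFamily μ n p B) (hp : ∀ j, 0 < p j ∧ p j ≤ 1)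
    (i t : ℕ) (H : Finset (ℕ × ℕ)) (β : ℕ × ℕ → Bool) (s : List (ℕ × ℕ)) (hH : InLayers n H)
    (hs : InLayers n s) :
    ∫⁻ ω in cylinder B H β, (freshCount n w ℓ (fun i j => B i j ω) i t H s : ENNReal) ∂μ
      ≤ ENNReal.ofReal (μ.real (cylinder B H β) * expectedCount n ℓ p i s) := by
  induction t generalizing H β s with
  | zero => simp [freshCount]
  | succ t ih =>
    rcases s with _ | ⟨y, s⟩
    · simp [freshCount]
    by_cases hyH : label w y ∈ H
    · simp [freshCount, hyH]
    have hy := hs y (by simp)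
    have hH' := hs.insert_label w hH
    have hM : 0 ≤ μ.real (cylinder B H β) := measureReal_nonneg
    have hΦ := fun s => expectedCount_nonneg (n := n) (ℓ := ℓ) hp i s
    have hp0 := (hp y.1).1.le
    have hp1 := sub_nonneg.mpr (hp y.1).2
    set e : ℝ := if y.1 = i then 1 else 0 with he
    have he0 : 0 ≤ e := by rw [he]; split_ifs <;> norm_num
    have hee : ((if y.1 = i then 1 else 0 : ℕ) : ENNReal) = ENNReal.ofReal e := by
      rw [he]; split_ifs <;> simp
    have hconst : ∀ x, ∫⁻ _ in cylinder B (insert (label w y) H) (Function.update β (label w y) x),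
        ENNReal.ofReal e ∂μ = ENNReal.ofReal (e * (valueProb p y.1 x * μ.real (cylinder B H β))) :=
      fun x => by
        have h := hB.measureReal_cylinder_insert hp hyH hH' β x
        rw [lintegral_const, Measure.restrict_apply_univ, ENNReal.ofReal_mul he0, ← ofReal_measureReal,
          h]
        rfl
    have h1 : ∫⁻ ω in cylinder B (insert (label w y) H) (Function.update β (label w y) true),
        (freshCount n w ℓ (fun i j => B i j ω) i (t + 1) H (y :: s) : ENNReal) ∂μ ≤
        ENNReal.ofReal (e * (p y.1 * μ.real (cylinder B H β)) +
          p y.1 * μ.real (cylinder B H β) * expectedCount n ℓ p i (children ℓ y ++ s)) := by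
      have h2 : ∫⁻ ω in cylinder B (insert (label w y) H) (Function.update β (label w y) true),
          ((if y.1 = n then 0 else freshCount n w ℓ (fun i j => B i j ω) i t (insert (label w y) H)
            (children ℓ y ++ s) : ℕ) : ENNReal) ∂μ ≤ ENNReal.ofReal (p y.1 * μ.real (cylinder B H β) *
              expectedCount n ℓ p i (children ℓ y ++ s)) := by
        rcases eq_or_ne y.1 n with hyn | hyn
        · simp [hyn]
        · simp only [if_neg hyn]
          refine (ih _ _ _ hH' (hs.children ℓ hyn)).trans_eq ?_
          rw [hB.measureReal_cylinder_insert hp hyH hH']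
          rfl
      rw [ENNReal.ofReal_add (mul_nonneg he0 (mul_nonneg hp0 hM))
        (mul_nonneg (mul_nonneg hp0 hM) (hΦ _))]
      refine le_trans (le_of_eq ?_) (add_le_add (hconst true).le h2)
      rw [← lintegral_add_left measurable_const]
      refine setLIntegral_congr_fun (measurableSet_cylinder hB hH' _) fun ω hω => ?_
      rw [cylinder_insert hyH] at hω
      have h5 : B y.1 (y.2 % 2 ^ w) ω = true := hω.2
      simp only [freshCount, hyH, if_false, h5, if_true]
      rw [← hee, ← Nat.cast_add]
    have h2 : ∫⁻ ω in cylinder B (insert (label w y) H) (Function.update β (label w y) false),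
        (freshCount n w ℓ (fun i j => B i j ω) i (t + 1) H (y :: s) : ENNReal) ∂μ ≤
        ENNReal.ofReal (e * ((1 - p y.1) * μ.real (cylinder B H β)) +
          (1 - p y.1) * μ.real (cylinder B H β) * expectedCount n ℓ p i s) := by
      have h2 := ih _ (Function.update β (label w y) false) s hH' hs.tail
      rw [hB.measureReal_cylinder_insert hp hyH hH'] at h2
      rw [ENNReal.ofReal_add (mul_nonneg he0 (mul_nonneg hp1 hM))
        (mul_nonneg (mul_nonneg hp1 hM) (hΦ _))]
      refine le_trans (le_of_eq ?_) (add_le_add (hconst false).le h2)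
      rw [← lintegral_add_left measurable_const]
      refine setLIntegral_congr_fun (measurableSet_cylinder hB hH' _) fun ω hω => ?_
      rw [cylinder_insert hyH] at hω
      have h5 : B y.1 (y.2 % 2 ^ w) ω = false := hω.2
      simp only [freshCount, hyH, if_false, h5, Bool.false_eq_true]
      rw [← hee, ← Nat.cast_add]
    rw [cylinder_eq_union hyH]
    refine (lintegral_union_le _ _ _).trans ((add_le_add h1 h2).trans ?_)
    rw [← cylinder_eq_union hyH, ← ENNReal.ofReal_add
      (add_nonneg (mul_nonneg he0 (mul_nonneg hp0 hM)) (mul_nonneg (mul_nonneg hp0 hM) (hΦ _)))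
      (add_nonneg (mul_nonneg he0 (mul_nonneg hp1 hM)) (mul_nonneg (mul_nonneg hp1 hM) (hΦ _)))]
    refine ENNReal.ofReal_le_ofReal ?_
    have h3 := mul_le_mul_of_nonneg_left
      (stepMean_expectedCount_le (ℓ := ℓ) hp i (Finset.mem_Icc.mp hy).2 s) hM
    refine le_trans (le_of_eq ?_) h3
    rw [stepMean, ← he]
    ring

lemma prod_le_measureReal_freshSuccess (hB : IsBernoulliFamily μ n p B)
    (hp : ∀ j, 0 < p j ∧ p j ≤ 1) (hn : 1 ≤ n) {t : ℕ} (ht : n ≤ t) (s : List (ℕ × ℕ)) :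
    ∏ i ∈ Finset.Icc 1 n, p i ≤
      μ.real {ω | FreshSuccess n w ℓ (fun i j => B i j ω) t ∅ ((1, 0) :: s)} := by
  have hH : InLayers n ((Finset.Icc 1 n).image fun i => (i, 0)) := by
    intro y hy
    obtain ⟨i, hi, rfl⟩ := Finset.mem_image.mp hy
    exact hi
  have h1 := hB.measureReal_cylinder hp hH fun _ => true
  rw [Finset.prod_image fun a _ a' _ h => (Prod.mk.inj h).1] at h1
  simp only [valueProb, if_true] at h1
  rw [← h1]
  refine measureReal_mono fun ω hω => ?_
  refine freshSuccess_of_zero (fun i hi => ?_) t 1 le_rfl hn (by omega) ∅ (by simp) s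
  exact hω (i, 0) (by simpa using hi)

end Probability

/-! ### Fragment lengths -/

section FragmentLengths

variable {n : ℕ} {p : ℕ → ℝ} {ε : ℝ} {ℓ : ℕ → ℕ}

/-- The prescribed prefix sums before rounding start at 0 and are nondecreasing, so the differences
of their ceilings are natural numbers. -/
lemma exists_isFragmentLengths (hp : ∀ i ∈ Finset.Icc 1 n, 0 < p i ∧ p i ≤ 1) (hε : 0 ≤ ε) :
    ∃ ℓ : ℕ → ℕ, IsFragmentLengths n p ε ℓ := by
  set f : ℕ → ℝ := fun i => ε * i + ∑ j ∈ Finset.Icc 1 i, Real.logb 2 (1 / p j) with hf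
  have h0 : f 0 = 0 := by simp [hf]
  have hstep : ∀ i < n, f i ≤ f (i + 1) := fun i hi => by
    obtain ⟨h1, h2⟩ := hp (i + 1) (Finset.mem_Icc.mpr ⟨by omega, by omega⟩)
    have h3 : 0 ≤ Real.logb 2 (1 / p (i + 1)) :=
      Real.logb_nonneg (by norm_num) (by rw [le_div_iff₀ h1]; linarith)
    simp only [hf]
    rw [Finset.sum_Icc_succ_top (by omega)]
    push_cast
    linarith
  have hnonneg : ∀ i ≤ n, 0 ≤ f i := fun i hi => by
    induction i with
    | zero => exact h0.ge
    | succ i ih => exact (ih (by omega)).trans (hstep i hi)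
  have hoff : ∀ i ≤ n, offset (fun i => ⌈f i⌉₊ - ⌈f (i - 1)⌉₊) i = ⌈f i⌉₊ := fun i hi => by
    induction i with
    | zero => simp [h0]
    | succ i ih =>
      have := Nat.ceil_mono (hstep i hi)
      rw [offset_succ, ih (by omega), Nat.add_sub_cancel]
      omega
  refine ⟨fun i => ⌈f i⌉₊ - ⌈f (i - 1)⌉₊, fun i hi => ?_⟩
  have hin := (Finset.mem_Icc.mp hi).2
  rw [hoff i hin]
  exact Int.natCast_ceil_eq_ceil (hnonneg i hin)

lemma IsFragmentLengths.unique {ℓ' : ℕ → ℕ} (h : IsFragmentLengths n p ε ℓ)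
    (h' : IsFragmentLengths n p ε ℓ') {i : ℕ} (hi : i ∈ Finset.Icc 1 n) : ℓ' i = ℓ i := by
  have heq : ∀ j ≤ n, offset ℓ' j = offset ℓ j := fun j hj => by
    rcases Nat.eq_zero_or_pos j with rfl | hj0
    · simp
    · have hj' := Finset.mem_Icc.mpr ⟨hj0, hj⟩
      exact_mod_cast (h' j hj').trans (h j hj').symm
  obtain ⟨h1, h2⟩ := Finset.mem_Icc.mp hi
  obtain ⟨k, rfl⟩ : ∃ k, i = k + 1 := ⟨i - 1, by omega⟩
  have h3 := heq (k + 1) h2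
  rw [offset_succ, offset_succ, heq k (by omega)] at h3
  omega

/-- The expected number of nodes of layer `m` all of whose ancestors below layer `0` are successful,
per node of layer `0`, when the node itself is required to be successful as well. -/
def meanWidth (ℓ : ℕ → ℕ) (p : ℕ → ℝ) (m : ℕ) : ℝ := 2 ^ offset ℓ m * ∏ j ∈ Finset.Icc 1 m, p j

lemma meanWidth_succ (m : ℕ) :
    meanWidth ℓ p (m + 1) = meanWidth ℓ p m * (2 ^ ℓ (m + 1) * p (m + 1)) := by
  rw [meanWidth, meanWidth, offset_succ, pow_add, Finset.prod_Icc_succ_top (by omega)]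
  ring

lemma meanWidth_mem (hp : ∀ j, 0 < p j ∧ p j ≤ 1) (h : IsFragmentLengths n p ε ℓ) {m : ℕ}
    (hm : m ≤ n) : (2 : ℝ) ^ (ε * m) ≤ meanWidth ℓ p m ∧
      meanWidth ℓ p m ≤ 2 * (2 : ℝ) ^ (ε * m) := by
  rcases Nat.eq_zero_or_pos m with rfl | hm0
  · simp [meanWidth]
  have h1 := h m (Finset.mem_Icc.mpr ⟨hm0, hm⟩)
  set S := ∑ j ∈ Finset.Icc 1 m, Real.logb 2 (1 / p j) with hS
  have hprod : ∏ j ∈ Finset.Icc 1 m, p j = (2 : ℝ) ^ (-S) := by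
    rw [hS, ← Finset.sum_neg_distrib, Real.rpow_sum_of_pos (by norm_num)]
    refine Finset.prod_congr rfl fun j _ => ?_
    rw [one_div, Real.logb_inv, neg_neg, Real.rpow_logb (by norm_num) (by norm_num) (hp j).1]
  have h2 : meanWidth ℓ p m = (2 : ℝ) ^ ((offset ℓ m : ℝ) - S) := by
    rw [meanWidth, hprod, ← Real.rpow_natCast, ← Real.rpow_add (by norm_num), sub_eq_add_neg]
  have h3 : ((offset ℓ m : ℤ) : ℝ) = offset ℓ m := by push_cast; rfl
  have h4 := Int.le_ceil (ε * m + S)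
  have h5 := Int.ceil_lt_add_one (ε * m + S)
  rw [← h1, h3] at h4 h5
  rw [h2]
  constructor
  · exact Real.rpow_le_rpow_of_exponent_le (by norm_num) (by linarith)
  · rw [mul_comm, ← Real.rpow_add_one (by norm_num)]
    exact Real.rpow_le_rpow_of_exponent_le (by norm_num) (by linarith)

/-- The left side is the quotient of consecutive mean widths, at most `2 * 2 ^ ε`: one factor 2
comes from rounding, the other from `ε ≤ 1`. -/
lemma two_pow_mul_le_four (hp : ∀ j, 0 < p j ∧ p j ≤ 1) (hε : ε ≤ 1)
    (h : IsFragmentLengths n p ε ℓ) {m : ℕ} (hm1 : 1 ≤ m) (hm : m ≤ n) : 2 ^ ℓ m * p m ≤ 4 := by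
  obtain ⟨k, rfl⟩ : ∃ k, m = k + 1 := ⟨m - 1, by omega⟩
  have h1 := (meanWidth_mem hp h hm).2
  have h2 := (meanWidth_mem hp h (m := k) (by omega)).1
  have h3 : (0 : ℝ) < 2 ^ (ε * k) := by positivity
  have h4 : (2 : ℝ) ^ (ε * (k + 1 : ℕ)) = 2 ^ (ε * k) * 2 ^ ε := by
    rw [← Real.rpow_add (by norm_num)]; push_cast; ring_nf
  have h5 : (2 : ℝ) ^ ε ≤ 2 := by
    simpa using Real.rpow_le_rpow_of_exponent_le (x := (2 : ℝ)) (by norm_num) hε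
  rw [meanWidth_succ, h4] at h1
  have h6 : 0 ≤ 2 ^ ℓ (k + 1) * p (k + 1) := mul_nonneg (by positivity) (hp _).1.le
  have h7 := mul_le_mul_of_nonneg_right h2 h6
  refine le_of_mul_le_mul_left ?_ h3
  nlinarith

lemma one_sub_pow_mul_le {u : ℝ} (h0 : 0 ≤ u) (h1 : u ≤ 1) (N : ℕ) :
    (1 - u) ^ N * (1 + N * u) ≤ 1 :=
  calc (1 - u) ^ N * (1 + N * u) ≤ (1 - u) ^ N * (1 + u) ^ N :=
        mul_le_mul_of_nonneg_left (one_add_mul_le_pow (by linarith) N)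
          (pow_nonneg (by linarith) N)
    _ = (1 - u ^ 2) ^ N := by rw [← mul_pow]; ring
    _ ≤ 1 := pow_le_one₀ (by nlinarith) (by nlinarith)

lemma one_le_two_rpow_mul (hε0 : 0 ≤ ε) (hε : ε ≤ 1) : 1 ≤ (2 : ℝ) ^ ε * (1 - ε / 2) := by
  have h := rpow_one_add_le_one_add_mul_self (s := -1 / 2) (by norm_num) hε0 hε
  have h2 : (1 + -1 / 2 : ℝ) ^ ε = ((2 : ℝ) ^ ε)⁻¹ := by
    rw [← Real.inv_rpow (by norm_num)]; norm_num
  rw [h2] at h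
  have h3 : (0 : ℝ) < 2 ^ ε := by positivity
  rw [inv_le_iff_one_le_mul₀' h3] at h
  rwa [neg_div, mul_neg, mul_one_div, ← sub_eq_add_neg] at h

/-- A successful node of layer `m` has a successful path to layer `n` with probability `Ω(ε)`. -/
lemma subtree_success_ge (hp : ∀ j, 0 < p j ∧ p j ≤ 1) (hε0 : 0 < ε) (hε : ε ≤ 1)
    (h : IsFragmentLengths n p ε ℓ) {m : ℕ} (hm : m ≤ n) :
    ε / 4 ≤ 1 - (1 - nodeProb n ℓ p (m + 1)) ^ 2 ^ ℓ (m + 1) := by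
  -- Write `r m` for the success probability below a successful node and `M m` for the mean width.
  -- Backward induction uses `r m ≥ x / (1 + x)` with `x * M m = r (m + 1) * M (m + 1)`. The surplus
  -- `2 ^ ε ≥ 1 / (1 - ε / 2)` compensates for the denominator.
  have key : (2 : ℝ) ^ (ε * m) * (ε / 2) ≤
      (1 - (1 - nodeProb n ℓ p (m + 1)) ^ 2 ^ ℓ (m + 1)) * meanWidth ℓ p m := by
    induction hm using Nat.decreasingInduction with
    | self =>
      rw [nodeProb_of_lt (Nat.lt_succ_self n), sub_self, zero_pow (by positivity), sub_zero, one_mul]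
      have h1 := (meanWidth_mem hp h le_rfl).1
      have h2 : (0 : ℝ) < 2 ^ (ε * n) := by positivity
      nlinarith
    | of_succ m hm ih =>
      obtain ⟨hq0, hq1⟩ := nodeProb_mem (n := n) (ℓ := ℓ) hp (m + 1)
      have h1 := one_sub_pow_mul_le hq0.le hq1 (2 ^ ℓ (m + 1))
      have h2 := (meanWidth_mem hp h (m := m) (by omega)).1
      have h3 := one_le_two_rpow_mul hε0.le hε
      have hpos := pow_nonneg (sub_nonneg.mpr hq1) (2 ^ ℓ (m + 1))
      rw [meanWidth_succ] at ih
      have h4 : (2 : ℝ) ^ (ε * (m + 1 : ℕ)) = 2 ^ (ε * m) * 2 ^ ε := by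
        rw [← Real.rpow_add (by norm_num)]; push_cast; ring_nf
      have h5 : (1 - (1 - nodeProb n ℓ p (m + 1 + 1)) ^ 2 ^ ℓ (m + 1 + 1)) *
          (meanWidth ℓ p m * (2 ^ ℓ (m + 1) * p (m + 1)))
          = 2 ^ ℓ (m + 1) * nodeProb n ℓ p (m + 1) * meanWidth ℓ p m := by
        rw [nodeProb_of_le hm]; ring
      rw [h4, h5] at ih
      have hA : (0 : ℝ) < 2 ^ (ε * m) := by positivity
      push_cast at h1
      set A : ℝ := 2 ^ (ε * m)
      set M := meanWidth ℓ p m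
      set x := 2 ^ ℓ (m + 1) * nodeProb n ℓ p (m + 1)
      have hx : 0 ≤ x := mul_nonneg (by positivity) hq0.le
      have hM : 0 ≤ M := hA.le.trans h2
      have h6 : x ≤ (1 - (1 - nodeProb n ℓ p (m + 1)) ^ 2 ^ ℓ (m + 1)) * (1 + x) := by linarith
      have h7 : A * (ε / 2) * (1 + x) ≤ x * M := by
        have h8 : A * (ε / 2) * x ≤ M * (ε / 2) * x := by gcongr
        have h9 : A * (ε / 2) ≤ x * M * (1 - ε / 2) := by
          calc A * (ε / 2) ≤ A * (ε / 2) * (2 ^ ε * (1 - ε / 2)) :=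
                le_mul_of_one_le_right (by positivity) h3
            _ = A * 2 ^ ε * (ε / 2) * (1 - ε / 2) := by ring
            _ ≤ _ := mul_le_mul_of_nonneg_right ih (by linarith)
        linarith
      refine le_of_mul_le_mul_right ?_ (show 0 < 1 + x by linarith)
      refine h7.trans ((mul_le_mul_of_nonneg_right h6 hM).trans_eq ?_)
      ring
  have h2 := (meanWidth_mem hp h hm).2
  obtain ⟨hq0, hq1⟩ := nodeProb_mem (n := n) (ℓ := ℓ) hp (m + 1)
  have h3 : 0 ≤ 1 - (1 - nodeProb n ℓ p (m + 1)) ^ 2 ^ ℓ (m + 1) :=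
    sub_nonneg.mpr (pow_le_one₀ (by linarith) (by linarith))
  have h4 := key.trans (mul_le_mul_of_nonneg_left h2 h3)
  have hA : (0 : ℝ) < 2 ^ (ε * m) := by positivity
  refine le_of_mul_le_mul_left ?_ hA
  linarith

lemma nodeProb_ge (hp : ∀ j, 0 < p j ∧ p j ≤ 1) (hε0 : 0 < ε) (hε : ε ≤ 1)
    (h : IsFragmentLengths n p ε ℓ) {m : ℕ} (hm : m ≤ n) : p m * (ε / 4) ≤ nodeProb n ℓ p m := by
  rw [nodeProb_of_le hm]
  exact mul_le_mul_of_nonneg_left (subtree_success_ge hp hε0 hε h hm) (hp m).1.le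

/-- Since `2 ^ ℓ 1 * p 1 ≥ 1`, the expected number of successful nodes in layer 1 is at least `2 ^ κ
* ε / 4`; the bound `(1 - u) ^ N ≤ 1 / (1 + N * u)` finishes. -/
lemma root_failure_le (hp : ∀ j, 0 < p j ∧ p j ≤ 1) (hn : 1 ≤ n) (hε0 : 0 < ε) (hε : ε ≤ 1)
    (h : IsFragmentLengths n p ε ℓ) (κ : ℕ) :
    (1 - nodeProb n ℓ p 1) ^ (2 ^ κ * 2 ^ ℓ 1) ≤ 4 / (2 ^ κ * ε) := by
  obtain ⟨hq0, hq1⟩ := nodeProb_mem (n := n) (ℓ := ℓ) hp 1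
  have h1 := one_sub_pow_mul_le hq0.le hq1 (2 ^ κ * 2 ^ ℓ 1)
  have h2 := nodeProb_ge hp hε0 hε h hn
  have h3 := (meanWidth_mem hp h hn).1
  have h4 : 1 ≤ 2 ^ ℓ 1 * p 1 := by
    have h5 : (1 : ℝ) ≤ 2 ^ (ε * (1 : ℕ)) := Real.one_le_rpow (by norm_num) (by simpa using hε0.le)
    simpa [meanWidth, offset] using h5.trans h3
  have h6 : 2 ^ κ * ε / 4 ≤ 1 + ((2 ^ κ * 2 ^ ℓ 1 : ℕ) : ℝ) * nodeProb n ℓ p 1 := by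
    push_cast
    calc 2 ^ κ * ε / 4 = 2 ^ κ * (ε / 4) * 1 := by ring
      _ ≤ 2 ^ κ * (ε / 4) * (2 ^ ℓ 1 * p 1) := mul_le_mul_of_nonneg_left h4 (by positivity)
      _ = 2 ^ κ * 2 ^ ℓ 1 * (p 1 * (ε / 4)) := by ring
      _ ≤ 2 ^ κ * 2 ^ ℓ 1 * nodeProb n ℓ p 1 := mul_le_mul_of_nonneg_left h2 (by positivity)
      _ ≤ _ := by linarith
  rw [le_div_iff₀ (by positivity)]
  have h7 := mul_le_mul_of_nonneg_left h6
    (pow_nonneg (sub_nonneg.mpr hq1) (2 ^ κ * 2 ^ ℓ 1))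
  linarith

end FragmentLengths

/-! ### The event of success without repeated inspections -/

lemma exists_success_event {Ω : Type*} [MeasurableSpace Ω] {μ : Measure Ω} [IsProbabilityMeasure μ]
    {n w κ : ℕ} {ℓ : ℕ → ℕ} {p : ℕ → ℝ} {ε : ℝ} {B : ℕ → ℕ → Ω → Bool} (hn : 1 ≤ n)
    (hp : ∀ j, 0 < p j ∧ p j ≤ 1) (hε0 : 0 < ε) (hε : ε ≤ 1) (hℓ : IsFragmentLengths n p ε ℓ)
    (hκ : κ ≤ w) (hB : IsBernoulliFamily μ n p B) :
    ∃ E : Set Ω, MeasurableSet E ∧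
      1 - (4 / (2 ^ κ * ε) + ∑ i ∈ Finset.Icc 1 n,
        4 * (n + 2 ^ κ) / (2 ^ w * (p i * (ε / 4)) ^ 2)) ≤ μ.real E ∧
      ∏ i ∈ Finset.Icc 1 n, p i ≤ μ.real E ∧
      (∀ ω ∈ E, ∃ σ, Returns n w ℓ (fun i j => B i j ω) σ ∧
        Valid n κ w ℓ (fun i j => B i j ω) n σ ∧ B n (seed w ℓ σ n) ω = true) ∧
      ∀ i ∈ Finset.Icc 1 n,
        ∫⁻ ω in E, ((trials n w ℓ (fun i j => B i j ω) i : ℕ∞) : ENNReal) ∂μ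
          ≤ ENNReal.ofReal (4 * (optTrials p i / ε)) := by
  set s := seg 1 0 (2 ^ κ * 2 ^ ℓ 1) with hs
  have hN : ∀ m, 1 ≤ m → m ≤ n → 2 ^ ℓ m * nodeProb n ℓ p m ≤ 4 := fun m h1 h2 =>
    (mul_le_mul_of_nonneg_left (nodeProb_le hp h2) (by positivity)).trans
      (two_pow_mul_le_four hp hε hℓ h1 h2)
  have hin : InLayers n s := fun y hy => by
    rw [mem_seg hy]; exact Finset.mem_Icc.mpr ⟨le_rfl, hn⟩
  have hempty : InLayers n (∅ : Finset (ℕ × ℕ)) := fun y hy => absurd hy (Finset.notMem_empty y)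
  have hcyl : cylinder B ∅ (fun _ => true) = Set.univ := by ext; simp [cylinder]
  -- Time `n` suffices for the direct descent, and `stackSize` ensures that failure is never caused
  -- by the time limit.
  set T := max n (stackSize n ℓ s) with hT
  have hE := measurableSet_freshSuccess (w := w) (ℓ := ℓ) hB T ∅ s hin
  refine ⟨{ω | FreshSuccess n w ℓ (fun i j => B i j ω) T ∅ s}, hE, ?_, ?_, fun ω hω => ?_,
    fun i hi => ?_⟩
  · have h1 := measureReal_not_freshSuccess_le (w := w) hB hp hN T ∅ (fun _ => true) s
      (le_max_right _ _) hempty hin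
    rw [hcyl, Set.univ_inter, probReal_univ, one_mul] at h1
    have h2 : μ.real {ω | ¬ FreshSuccess n w ℓ (fun i j => B i j ω) T ∅ s} =
        1 - μ.real {ω | FreshSuccess n w ℓ (fun i j => B i j ω) T ∅ s} :=
      probReal_compl_eq_one_sub hE
    have h3 := potential_seg_le (w := w) hp hn hN κ
    have h4 := root_failure_le hp hn hε0 hε hℓ κ
    have h5 : ∑ i ∈ Finset.Icc 1 n, 4 * (n + 2 ^ κ) / (2 ^ w * nodeProb n ℓ p i ^ 2) ≤
        ∑ i ∈ Finset.Icc 1 n, 4 * (n + 2 ^ κ) / (2 ^ w * (p i * (ε / 4)) ^ 2) := by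
      refine Finset.sum_le_sum fun i hi => ?_
      have h6 := nodeProb_ge hp hε0 hε hℓ (Finset.mem_Icc.mp hi).2
      have h7 := (hp i).1
      gcongr
    rw [← hs] at h3
    linarith
  · have h1 : s = (1, 0) :: seg 1 1 (2 ^ κ * 2 ^ ℓ 1 - 1) := by
      rw [hs, ← Nat.sub_add_cancel (show 1 ≤ 2 ^ κ * 2 ^ ℓ 1 from
        Nat.succ_le_of_lt (by positivity)), seg_succ, Nat.add_sub_cancel]
    rw [h1]
    exact prod_le_measureReal_freshSuccess hB hp hn (le_max_left _ _) _
  · exact (run_of_freshSuccess hn hκ hω).1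
  · obtain ⟨hi1, hin'⟩ := Finset.mem_Icc.mp hi
    have h1 := lintegral_freshCount_le (w := w) (ℓ := ℓ) hB hp i T ∅ (fun _ => true) s hempty hin
    rw [hcyl, probReal_univ, one_mul, Measure.restrict_univ] at h1
    calc ∫⁻ ω in {ω | FreshSuccess n w ℓ (fun i j => B i j ω) T ∅ s},
          ((trials n w ℓ (fun i j => B i j ω) i : ℕ∞) : ENNReal) ∂μ
        ≤ ∫⁻ ω in {ω | FreshSuccess n w ℓ (fun i j => B i j ω) T ∅ s},
          (freshCount n w ℓ (fun i j => B i j ω) i T ∅ s : ENNReal) ∂μ := by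
          refine setLIntegral_mono' hE fun ω hω => ?_
          have h2 := (run_of_freshSuccess hn hκ hω).2 i
          exact (ENat.toENNReal_le.mpr h2).trans_eq (ENat.toENNReal_coe _)
      _ ≤ ∫⁻ ω, (freshCount n w ℓ (fun i j => B i j ω) i T ∅ s : ENNReal) ∂μ :=
          setLIntegral_le_lintegral _ _
      _ ≤ _ := h1
      _ ≤ _ := by
          refine ENNReal.ofReal_le_ofReal ((expectedCount_seg_le hp hi1 _).trans ?_)
          have h2 := nodeProb_ge hp hε0 hε hℓ hin'
          have h3 := (hp i).1
          calc 1 / nodeProb n ℓ p i ≤ 1 / (p i * (ε / 4)) := by gcongr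
            _ = _ := by rw [optTrials]; field_simp

lemma IsFragmentLengths.congr {n : ℕ} {p p' : ℕ → ℝ} {ε : ℝ} {ℓ : ℕ → ℕ}
    (h : IsFragmentLengths n p ε ℓ) (hpp : ∀ i ∈ Finset.Icc 1 n, p' i = p i) :
    IsFragmentLengths n p' ε ℓ := fun i hi => by
  rw [h i hi]
  congr 2
  refine Finset.sum_congr rfl fun j hj => ?_
  rw [hpp j (Finset.Icc_subset_Icc_right (Finset.mem_Icc.mp hi).2 hj)]

/-- With `a = n ^ c`, the pair term per layer is of order `n * a ^ 2 * a ^ 4 / (n ^ 2 * a ^ 7) = 1 /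
(n * a)`, which explains the exponents 2 and 7. The constant is `4 + 192`, where `192 = 4 * 3 * 16`.
-/
lemma failure_bound_le {n w κ : ℕ} {p : ℕ → ℝ} {ε a : ℝ} (hn : 1 ≤ n) (ha : 1 ≤ a)
    (hp : ∀ i ∈ Finset.Icc 1 n, 1 / a ≤ p i) (hε : 1 / a ≤ ε) (hκ : a ^ 2 ≤ 2 ^ κ)
    (hκ' : (2 : ℝ) ^ κ ≤ 2 * a ^ 2) (hw : (n : ℝ) ^ 2 * a ^ 7 ≤ 2 ^ w) :
    4 / (2 ^ κ * ε) + ∑ i ∈ Finset.Icc 1 n, 4 * (n + 2 ^ κ) / (2 ^ w * (p i * (ε / 4)) ^ 2)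
      ≤ 196 * (1 / a) := by
  have ha0 : 0 < a := by linarith
  have hε0 : 0 < ε := lt_of_lt_of_le (by positivity) hε
  have hn1 : (1 : ℝ) ≤ n := by exact_mod_cast hn
  have h1 : 4 / (2 ^ κ * ε) ≤ 4 * (1 / a) := by
    calc 4 / (2 ^ κ * ε) ≤ 4 / (a ^ 2 * (1 / a)) := by gcongr
      _ = _ := by field_simp
  have h2 : ∀ i ∈ Finset.Icc 1 n, 4 * (n + 2 ^ κ) / (2 ^ w * (p i * (ε / 4)) ^ 2) ≤
      192 * (1 / a) / n := fun i hi => by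
    have h3 := hp i hi
    have hpi : 0 < p i := lt_of_lt_of_le (by positivity) h3
    have h4 : (n : ℝ) + 2 ^ κ ≤ 3 * n * a ^ 2 := by nlinarith [one_le_pow₀ ha (n := 2)]
    calc 4 * (n + 2 ^ κ) / (2 ^ w * (p i * (ε / 4)) ^ 2)
        ≤ 4 * (3 * n * a ^ 2) / (n ^ 2 * a ^ 7 * (1 / a * (1 / a / 4)) ^ 2) := by gcongr
      _ = _ := by field_simp; norm_num
  have h3 := Finset.sum_le_card_nsmul _ _ _ h2
  rw [Nat.card_Icc, Nat.add_sub_cancel, nsmul_eq_mul, mul_div_cancel₀ _ (by positivity)] at h3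
  linarith

end Consensus

/-! ### Choice of parameters and constants -/

theorem mainTheorem1 (c : ℝ) (hc : 0 < c) :
    ∃ C : ℝ, 0 < C ∧
      ∀ (n : ℕ) (p : ℕ → ℝ) (ε : ℝ), 1 ≤ n →
        (∀ i ∈ Finset.Icc 1 n, (n : ℝ) ^ (-c) < p i ∧ p i ≤ 1) →
        (n : ℝ) ^ (-c) < ε → ε ≤ 1 →
        -- the fragment lengths exist and are unique
        (∃ ℓ : ℕ → ℕ, Consensus.IsFragmentLengths n p ε ℓ ∧
          ∀ ℓ' : ℕ → ℕ, Consensus.IsFragmentLengths n p ε ℓ' →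
            ∀ i ∈ Finset.Icc 1 n, ℓ' i = ℓ i) ∧
        ∀ (ℓ : ℕ → ℕ), Consensus.IsFragmentLengths n p ε ℓ →
        ∀ (w : ℕ), (2 + 7 * c) * Real.logb 2 (n : ℝ) ≤ (w : ℝ) →
        ∀ (Ω : Type*) [MeasurableSpace Ω] (μ : MeasureTheory.Measure Ω)
          [MeasureTheory.IsProbabilityMeasure μ] (B : ℕ → ℕ → Ω → Bool),
          Consensus.IsBernoulliFamily μ n p B →
          ∃ E : Set Ω, MeasurableSet E ∧ 0 < μ E ∧
            1 - C * (n : ℝ) ^ (-c) ≤ μ.real E ∧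
            (∀ ω ∈ E, ∃ σ : ℕ → ℕ,
              Consensus.Returns n w ℓ (fun i j => B i j ω) σ ∧
              Consensus.SolvesSSEP n (fun i j => B i j ω)
                (fun M i => Consensus.ofBits (Consensus.window w M (Consensus.offset ℓ i)))
                (Consensus.encode n w ℓ σ) ∧
              ((Consensus.encode n w ℓ σ).length : ℤ)
                = ⌈Consensus.optSpace n p + ε * (n : ℝ) + (w : ℝ)⌉ ∧
              ∀ i ∈ Finset.Icc 1 n,
                Consensus.window w (Consensus.encode n w ℓ σ) (Consensus.offset ℓ i)
                  = Consensus.toBits w (Consensus.seed w ℓ σ i)) ∧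
            ∀ i ∈ Finset.Icc 1 n,
              ∫⁻ ω, ((Consensus.trials n w ℓ (fun i j => B i j ω) i : ℕ∞) : ENNReal)
                  ∂(ProbabilityTheory.cond μ E)
                ≤ ENNReal.ofReal (C * (Consensus.optTrials p i / ε)) := by
  -- This is a lower bound for the probability of `E` depending only on `c`, needed because
  -- conditioning divides by that probability. The threshold is `392 = 2 * 196`: for `n ^ c ≥ 392`
  -- the failure bound is at most `1 / 2`.
  have hδ : 0 < (392 : ℝ) ^ (-(392 : ℝ) ^ (1 / c)) / 2 := by positivity
  set δ : ℝ := (392 : ℝ) ^ (-(392 : ℝ) ^ (1 / c)) / 2 with hδ_def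
  refine ⟨196 + 4 / δ, by positivity, fun n p ε hn hp hεn hε => ?_⟩
  have hn1 : (1 : ℝ) ≤ n := by exact_mod_cast hn
  have hn0 : (0 : ℝ) < n := by linarith
  have hnc : 0 < (n : ℝ) ^ (-c) := by positivity
  have hε0 : 0 < ε := hnc.trans hεn
  have hp01 : ∀ i ∈ Finset.Icc 1 n, 0 < p i ∧ p i ≤ 1 := fun i hi =>
    ⟨hnc.trans (hp i hi).1, (hp i hi).2⟩
  refine ⟨?_, fun ℓ hℓ w hw Ω _ μ _ B hB => ?_⟩
  · obtain ⟨ℓ, hℓ⟩ := Consensus.exists_isFragmentLengths hp01 hε0.le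
    exact ⟨ℓ, hℓ, fun ℓ' hℓ' i hi => hℓ.unique hℓ' hi⟩
  -- Extension by 1 gives the bounds on the parameters at every index without changing the problem.
  set p' : ℕ → ℝ := fun i => if i ∈ Finset.Icc 1 n then p i else 1 with hp'_def
  have hpp : ∀ i ∈ Finset.Icc 1 n, p' i = p i := fun i hi => if_pos hi
  have hp' : ∀ j, 0 < p' j ∧ p' j ≤ 1 := fun j => by
    by_cases hj : j ∈ Finset.Icc 1 n
    · rw [hpp j hj]; exact hp01 j hj
    · simp only [hp'_def, if_neg hj]
      norm_num
  have hB' : Consensus.IsBernoulliFamily μ n p' B :=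
    ⟨hB.measurable, hB.indep, fun i hi j => by rw [hB.prob i hi j, hpp i hi]⟩
  set a : ℝ := (n : ℝ) ^ c with ha_def
  have ha : 1 ≤ a := Real.one_le_rpow hn1 hc.le
  have hinv : (n : ℝ) ^ (-c) = 1 / a := by rw [Real.rpow_neg hn0.le, one_div]
  have hlog : 0 ≤ Real.logb 2 (n : ℝ) := Real.logb_nonneg (by norm_num) hn1
  have htwo : ∀ x : ℝ, (2 : ℝ) ^ (x * Real.logb 2 n) = (n : ℝ) ^ x := fun x => by
    rw [mul_comm, Real.rpow_mul (by norm_num), Real.rpow_logb (by norm_num) (by norm_num) hn0]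
  -- About `a ^ 2` values of `σ 0`: one factor `a` absorbs `1 / ε` in the root failure, the other
  -- provides the error `1 / a`. More values would only add collisions.
  set κ := ⌈2 * c * Real.logb 2 (n : ℝ)⌉₊ with hκ_def
  have hκw : κ ≤ w := Nat.ceil_le.mpr (le_trans (by nlinarith) hw)
  have ha2 : a ^ 2 = (n : ℝ) ^ (2 * c) := by
    rw [ha_def, ← Real.rpow_natCast, ← Real.rpow_mul hn0.le, mul_comm]; norm_num
  have hκ1 : a ^ 2 ≤ 2 ^ κ := by
    rw [ha2, ← htwo, ← Real.rpow_natCast 2 κ]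
    exact Real.rpow_le_rpow_of_exponent_le (by norm_num) (Nat.le_ceil _)
  have hκ2 : (2 : ℝ) ^ κ ≤ 2 * a ^ 2 := by
    rw [ha2, ← htwo, ← Real.rpow_natCast 2 κ, mul_comm (2 : ℝ) (_ ^ _),
      ← Real.rpow_add_one (by norm_num)]
    exact Real.rpow_le_rpow_of_exponent_le (by norm_num)
      (Nat.ceil_lt_add_one (by positivity)).le
  have hwa : (n : ℝ) ^ 2 * a ^ 7 ≤ 2 ^ w := by
    have h1 : (n : ℝ) ^ 2 * a ^ 7 = (n : ℝ) ^ (2 + 7 * c) := by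
      rw [Real.rpow_add hn0, ha_def, ← Real.rpow_natCast (_ ^ c), ← Real.rpow_mul hn0.le, mul_comm c]
      norm_num
    rw [h1, ← htwo, ← Real.rpow_natCast 2 w]
    exact Real.rpow_le_rpow_of_exponent_le (by norm_num) hw
  obtain ⟨E, hE, hE1, hE2, hE3, hE4⟩ := Consensus.exists_success_event hn hp' hε0 hε
    (hℓ.congr hpp) hκw hB'
  have hbound := Consensus.failure_bound_le (p := p') hn ha
    (fun i hi => by rw [hpp i hi, ← hinv]; exact (hp i hi).1.le) (hinv ▸ hεn.le) hκ1 hκ2 hwa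
  have hE5 : 1 - 196 * (1 / a) ≤ μ.real E := by linarith
  have hδE : δ ≤ μ.real E := by
    rcases le_or_gt 392 a with h | h
    · have h1 : (392 : ℝ) ^ (-(392 : ℝ) ^ (1 / c)) ≤ 1 :=
        Real.rpow_le_one_of_one_le_of_nonpos (by norm_num) (by simp; positivity)
      have h2 : 1 / a ≤ 1 / 392 := one_div_le_one_div_of_le (by norm_num) h
      linarith
    -- For small `a` both `n` and all `1 / p i` are bounded in terms of `c`, so the direct descent
    -- alone has probability at least `δ`.
    · have h1 : (n : ℝ) ≤ (392 : ℝ) ^ (1 / c) := by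
        have h2 : (n : ℝ) = a ^ (1 / c) := by
          rw [ha_def, ← Real.rpow_mul hn0.le, mul_one_div_cancel hc.ne', Real.rpow_one]
        rw [h2]
        exact Real.rpow_le_rpow (by linarith) h.le (by positivity)
      have h2 : (392 : ℝ) ^ (-(392 : ℝ) ^ (1 / c)) ≤ (1 / 392) ^ n := by
        rw [one_div_pow, one_div ((392 : ℝ) ^ n), ← Real.rpow_natCast, ← Real.rpow_neg (by norm_num)]
        exact Real.rpow_le_rpow_of_exponent_le (by norm_num) (by linarith)
      have h3 : (1 / 392 : ℝ) ^ n ≤ ∏ i ∈ Finset.Icc 1 n, p' i := by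
        have h4 := Finset.prod_le_prod (s := Finset.Icc 1 n) (f := fun _ => (1 / 392 : ℝ)) (g := p')
          (fun _ _ => by norm_num) fun i hi => by
            rw [hpp i hi]
            refine le_trans ?_ (hinv ▸ (hp i hi).1.le)
            exact one_div_le_one_div_of_le (by linarith) h.le
        rwa [Finset.prod_const, Nat.card_Icc, Nat.add_sub_cancel] at h4
      have h4 : 0 < (392 : ℝ) ^ (-(392 : ℝ) ^ (1 / c)) := by positivity
      linarith
  have hE0 : 0 < μ.real E := hδ.trans_le hδE
  have hμE : 0 < μ E := by
    by_contra h
    rw [not_lt, nonpos_iff_eq_zero] at h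
    rw [Measure.real, h] at hE0
    simp at hE0
  refine ⟨E, hE, hμE, ?_, fun ω hω => ?_, fun i hi => ?_⟩
  · rw [hinv]
    have : 0 ≤ 4 / δ * (1 / a) := by positivity
    linarith
  · obtain ⟨σ, h1, h2, h3⟩ := hE3 ω hω
    refine ⟨σ, h1, Consensus.solvesSSEP_encode h2 h3, ?_, fun i hi =>
      Consensus.window_encode (Finset.mem_Icc.mp hi).2 w ℓ σ h2.lt⟩
    rw [Consensus.length_encode, Int.ceil_add_natCast, add_comm (Consensus.optSpace n p),
      Consensus.optSpace, ← hℓ n (Finset.mem_Icc.mpr ⟨hn, le_rfl⟩)]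
    push_cast
    ring
  · have h1 := hE4 i hi
    have hpi := hp01 i hi
    have h2 : Consensus.optTrials p' i = Consensus.optTrials p i := by
      rw [Consensus.optTrials, Consensus.optTrials, hpp i hi]
    have h0 : 0 ≤ Consensus.optTrials p i / ε :=
      div_nonneg (one_div_nonneg.mpr hpi.1.le) hε0.le
    rw [h2] at h1
    rw [ProbabilityTheory.cond, lintegral_smul_measure, smul_eq_mul]
    calc (μ E)⁻¹ * ∫⁻ ω in E, ((Consensus.trials n w ℓ (fun i j => B i j ω) i : ℕ∞) : ENNReal) ∂μ
        ≤ ENNReal.ofReal (1 / δ) * ENNReal.ofReal (4 * (Consensus.optTrials p i / ε)) := by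
          refine mul_le_mul' ?_ h1
          rw [← ofReal_measureReal, ← ENNReal.ofReal_inv_of_pos hE0, ← one_div]
          exact ENNReal.ofReal_le_ofReal (one_div_le_one_div_of_le hδ hδE)
      _ = ENNReal.ofReal (1 / δ * (4 * (Consensus.optTrials p i / ε))) :=
          (ENNReal.ofReal_mul (by positivity)).symm
      _ ≤ _ := by
          refine ENNReal.ofReal_le_ofReal ?_
          calc 1 / δ * (4 * (Consensus.optTrials p i / ε))
              = 4 / δ * (Consensus.optTrials p i / ε) := by ring
            _ ≤ _ := mul_le_mul_of_nonneg_right (by linarith) h0
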